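/- Let $H$ be a Hermitian $N\times N$ matrix with smallest eigenvalue $E_0$ and ground space $\mathcal G=\ker(H-E_0)\subset\mathbb C^N$, $g=\dim\mathcal G$. A preparation rule is a map $(\omega,K)\mapsto \mathcal P_\omega(K)\in\mathbb C^N$ of an internal randomness $\omega$ and a matrix $K$, such that $(R,\omega)\mapsto\mathcal P_\omega(R^\dagger HR)$ is measurable on $U(N)\times\Omega$. Run $M$ branches with random pairs $(R_i,\omega_i)$, $i=1,\dots,M$, that are mutually independent, where $R_i$ is Haar distributed on $U(N)$ and independent of $\omega_i$. Let $H_i=R_i^\dagger HR_i$, let $\mathcal G_i=R_i^\dagger\mathcal G$ be its ground space, let $\tilde\phi_i=\mathcal P_{\omega_i}(H_i)$, and assume $\Pi_{\mathcal G_i}\tilde\phi_i\neq0$ almost surely for every $i$. The foot-point is $f(R,\omega)=Rv^*$, where $v^*$ is the normalized projection of $\mathcal P_\omega(R^\dagger HR)$ onto $R^\dagger\mathcal G$, and $\hat w=f/\|f\|$. For a subspace $V\subset\mathcal G$ let $d_{FS}(\hat w,V)=\arccos\|\Pi_V\hat w\|$. For $\eta\in(0,1]$ and $\delta>0$, the pair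 $(\nu,f)$ satisfies $(\eta,\delta)$-anti-concentration if for almost every $\omega$ and every complex hyperplane $V\subset\mathcal G$ one has $\Pr_{R\sim\nu}[d_{FS}(\hat w(R,\omega),V)\ge\delta]\ge\eta$. Then, on every branch $i$: 1. For almost every value $\omega$ of $\omega_i$, under Haar distributed $R$ the vector $\hat w(R,\omega)$ is uniform on the unit sphere of $\mathcal G\cong\mathbb C^g$; hence $\hat w(R_i,\omega_i)$ is uniform there too. 2. For every unit vector $n\in\mathcal G$, $|\langle n,\hat w\rangle|^2$ has the $\mathrm{Beta}(1,g-1)$ law (for $g=1$: the point mass at $1$), both for almost every fixed $\omega$ and unconditionally. For almost every $\omega$ it satisfies $\Pr_R[|\langle n,\hat w\rangle|^2\ge t]=(1-t)^{g-1}$ for all such $n$ and all $0\le t\le1$ (with $0^0=1$). 3. For almost every $\omega$, every complex hyperplane $V\subset\mathcal G$ and every $0\le\delta\le\pi/2$, $\Pr_R[d_{FS}(\hat w,V)\ge\delta]=\eta_{\mathrm{Haar}}(\delta):=\cos^{2(g-1)}\delta$. Consequently (Haar, $f$) satisfies $(\eta_{\mathrm{Haar}}(\delta),\delta)$-anti-concentration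 for every $0<\delta<\pi/2$. 4. As $\delta\to0^+$, $\eta_{\mathrm{Haar}}(\delta)\to1$ and $\eta_{\mathrm{Haar}}(\delta)^g\to1$. If $M\ge g$, then for every orthonormal basis $v_1,\dots,v_g$ of $\mathcal G$ the foot-point matrix $F_{k,i}=\langle v_k,R_i\tilde\phi_i\rangle$ satisfies $\Pr[\operatorname{rank}F=g]\ge\eta_{\mathrm{Haar}}(\delta)^g$ for every $0<\delta<\pi/2$, and in the limit $\operatorname{rank}F=g$ almost surely; equivalently, the vectors $\Pi_{\mathcal G}R_i\tilde\phi_i$, $1\le i\le M$, span $\mathcal G$ almost surely. -/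

import Mathlib

open MeasureTheory ProbabilityTheory Filter Topology Module

noncomputable section

/-- The state space `ℂ^N` with its Hermitian inner product. -/
abbrev Hilb (N : ℕ) : Type := EuclideanSpace ℂ (Fin N)

/-- Square complex matrices of size `N`. -/
abbrev CMat (N : ℕ) : Type := Matrix (Fin N) (Fin N) ℂ

/-- The unitary group `U(N)`. -/
abbrev UN (N : ℕ) : Type := Matrix.unitaryGroup (Fin N) ℂ

/-- `U(N)` carries its Borel σ-algebra. -/
instance instMeasurableSpaceUN (N : ℕ) : MeasurableSpace (UN N) := borel (UN N)

instance instBorelSpaceUN (N : ℕ) : BorelSpace (UN N) := ⟨rfl⟩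

theorem isCompact_unitaryGroup (N : ℕ) :
    IsCompact (Matrix.unitaryGroup (Fin N) ℂ : Set (CMat N)) := by
  have hK : IsCompact (Set.pi Set.univ fun _ : Fin N =>
      Set.pi Set.univ fun _ : Fin N => Metric.closedBall (0 : ℂ) 1) :=
    isCompact_univ_pi fun _ => isCompact_univ_pi fun _ => isCompact_closedBall 0 1
  refine hK.of_isClosed_subset ?_ ?_
  · have h : (Matrix.unitaryGroup (Fin N) ℂ : Set (CMat N)) = {A | A * star A = 1} := by
      ext A
      exact Matrix.mem_unitaryGroup_iff
    rw [h]
    exact isClosed_eq (by fun_prop) continuous_const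
  · intro A hA i _ j _
    simpa using entry_norm_bound_of_unitary hA i j

instance instCompactSpaceUN (N : ℕ) : CompactSpace (UN N) :=
  isCompact_iff_compactSpace.mp (isCompact_unitaryGroup N)

/-- The Haar probability measure on `U(N)`. -/
def unitaryHaar (N : ℕ) : Measure (UN N) := Measure.haarMeasure ⊤

instance instIsProbabilityMeasureUnitaryHaar (N : ℕ) :
    IsProbabilityMeasure (unitaryHaar N) :=
  ⟨by simpa [unitaryHaar] using
    Measure.haarMeasure_self (K₀ := (⊤ : TopologicalSpace.PositiveCompacts (UN N)))⟩

/-- The action of a matrix on a state. -/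
def act {N : ℕ} (A : CMat N) (x : Hilb N) : Hilb N := Matrix.toEuclideanLin A x

/-- The eigenspace of `K` at the real number `E₀`. -/
def energySpace {N : ℕ} (K : CMat N) (E₀ : ℝ) : Submodule ℂ (Hilb N) :=
  End.eigenspace (Matrix.toEuclideanLin K) (E₀ : ℂ)

/-- `E₀` is the smallest eigenvalue of `H`. -/
def IsGroundEnergy {N : ℕ} (H : CMat N) (E₀ : ℝ) : Prop :=
  IsLeast {E : ℝ | End.HasEigenvalue (Matrix.toEuclideanLin H) (E : ℂ)} E₀

/-- The rotated Hamiltonian `R† H R`. -/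
def rotated {N : ℕ} (H : CMat N) (R : UN N) : CMat N :=
  (R : CMat N).conjTranspose * H * (R : CMat N)

/-- The unit vector `v* ∈ R†𝓖`: the normalized component of the output of the preparation rule
on `R† H R`, with internal randomness `w`, in the ground space of `R† H R`. -/
def groundComponent {N : ℕ} {Ω : Type*} (H : CMat N) (E₀ : ℝ) (prep : Ω → CMat N → Hilb N)
    (R : UN N) (w : Ω) : Hilb N :=
  NormedSpace.normalize
    ((energySpace (rotated H R) E₀).starProjection (prep w (rotated H R)))

/-- The foot-point `f(R, w) = R v*`. -/
def footPoint {N : ℕ} {Ω : Type*} (H : CMat N) (E₀ : ℝ) (prep : Ω → CMat N → Hilb N)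
    (R : UN N) (w : Ω) : Hilb N :=
  act (R : CMat N) (groundComponent H E₀ prep R w)

/-- The normalized foot-point `ŵ = f / ‖f‖` of a foot-point map `f`. -/
def normalizedFootPoint {N : ℕ} {Ω : Type*} (f : UN N → Ω → Hilb N) (R : UN N) (w : Ω) :
    Hilb N :=
  NormedSpace.normalize (f R w)

/-- The uniform probability measure on the unit sphere of a complex Euclidean space: the
normalized surface measure. -/
def uniformSphere (E : Type*) [NormedAddCommGroup E] [InnerProductSpace ℂ E]
    [FiniteDimensional ℂ E] [MeasurableSpace E] [BorelSpace E] :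
    Measure (Metric.sphere (0 : E) 1) :=
  letI : InnerProductSpace ℝ E := InnerProductSpace.complexToReal
  haveI : FiniteDimensional ℝ E := FiniteDimensional.complexToReal E
  ((volume : Measure E).toSphere Set.univ)⁻¹ • (volume : Measure E).toSphere

/-- The uniform probability measure on the unit sphere of a subspace `G`, as a measure on the
ambient space. -/
def uniformOnSphere {N : ℕ} (G : Submodule ℂ (Hilb N)) : Measure (Hilb N) :=
  (uniformSphere G).map (fun x : Metric.sphere (0 : G) 1 => ((x : G) : Hilb N))

/-- The `Beta(1, g - 1)` law; for `g = 1` it is the point mass at `1`. -/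
def betaOneLaw (g : ℕ) : Measure ℝ :=
  if g = 1 then Measure.dirac 1 else betaMeasure 1 ((g : ℝ) - 1)

/-- The Fubini–Study distance `arccos ‖Π_V x‖` from a unit vector to a subspace. -/
def fsDist {N : ℕ} (x : Hilb N) (V : Submodule ℂ (Hilb N)) : ℝ :=
  Real.arccos ‖V.starProjection x‖

/-- `V` is a complex hyperplane (codimension-one subspace) of `G`. -/
def IsHyperplaneOf {N : ℕ} (V G : Submodule ℂ (Hilb N)) : Prop :=
  V ≤ G ∧ finrank ℂ V + 1 = finrank ℂ G

/-- `(η, δ)`-anti-concentration over `G` of the pair `(ν, f)`, where `P` is the law of the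
internal randomness. -/
def AntiConcentration {N : ℕ} {Ω : Type*} [MeasurableSpace Ω] (ν : Measure (UN N))
    (P : Measure Ω) (G : Submodule ℂ (Hilb N)) (f : UN N → Ω → Hilb N) (η δ : ℝ) : Prop :=
  0 < η ∧ η ≤ 1 ∧ 0 < δ ∧
    ∀ᵐ w ∂P, ∀ V : Submodule ℂ (Hilb N), IsHyperplaneOf V G →
      η ≤ ν.real {R | δ ≤ fsDist (normalizedFootPoint f R w) V}

/-- `η_Haar(δ) = cos^{2(g-1)} δ`. -/
def haarEta (g : ℕ) (δ : ℝ) : ℝ := Real.cos δ ^ (2 * (g - 1))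

/-- The foot-point matrix with entries `⟨v_k, R_i φ̃_i⟩`, where `φ̃_i` is the output of the
preparation rule on the `i`-th rotated Hamiltonian. -/
def footMatrix {N g M : ℕ} {Ω : Type*} (H : CMat N) (prep : Ω → CMat N → Hilb N)
    (v : Fin g → Hilb N) (R : Fin M → UN N) (w : Fin M → Ω) : Matrix (Fin g) (Fin M) ℂ :=
  Matrix.of fun k i => inner ℂ (v k) (act (R i : CMat N) (prep (w i) (rotated H (R i))))

end

/-!
Fix the internal randomness `w`. If a unitary `W` commutes with `H`, then `R` and `W R` produce the
same rotated Hamiltonian, hence the same output of the preparation rule, so the normalized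
foot-point satisfies `ŵ(W R, w) = W ŵ(R, w)`. Every unitary of the ground space `𝓖`, extended by the
identity on `𝓖ᗮ`, commutes with `H`. Left invariance of Haar measure therefore makes the law of
`ŵ(·, w)` invariant under all unitaries of `𝓖` (`exists_unitaryGroup_groundDirection_mul`).

A probability measure on the unit sphere of a complex inner product space that is invariant under
all unitaries is unique (`measure_eq_of_forall_map_linearIsometryEquiv_eq`). The characteristic
function of such a measure `ρ` depends only on the norm, so averaging it over a second one `σ` gives
`φ_ρ(t) = ∫∫ exp(i ‖t‖ ⟪x, y⟫) dρ(x) dσ(y)`, which is symmetric in `ρ` and `σ`. Hence the law of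
`ŵ(·, w)` is the normalized surface measure.

By the same uniqueness, the overlap `‖⟪n, x⟫‖²` under that measure can be computed for the direction
of a Gaussian vector. Splitting off the complex line through `n`, its tail is a product of Gaussian
integrals, `(1 - t) ^ (g - 1)` (`setLIntegral_cone_exp_neg_norm_sq`), and this tail characterizes
the `Beta(1, g - 1)` law. The escape probability from a hyperplane is the overlap with its unit
normal, because `‖Π_V x‖² = 1 - ‖⟪n, x⟫‖²`.

In particular a proper subspace is null for the uniform law, so `g` independent uniform directions
are almost surely linearly independent, each new one avoiding the span of the previous ones. The
foot-point matrix collects the coordinates of the ground components of the outputs, which are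
multiples of these directions.
-/

noncomputable section

/-! ### Uniqueness of the invariant law on the sphere -/

section Sphere

attribute [local instance] InnerProductSpace.complexToReal FiniteDimensional.complexToReal

variable {E : Type*} [NormedAddCommGroup E] [InnerProductSpace ℂ E] [FiniteDimensional ℂ E]

/-- The unitary group acts transitively on each sphere. -/
theorem exists_linearIsometryEquiv_apply_eq {x y : E} (h : ‖x‖ = ‖y‖) :
    ∃ W : E ≃ₗᵢ[ℂ] E, W x = y := by
  rcases eq_or_ne x 0 with rfl | hx
  · exact ⟨LinearIsometryEquiv.refl ℂ E, by simpa [eq_comm] using h⟩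
  have hn : (‖x‖ : ℂ) ≠ 0 := by simpa using hx
  -- both vectors are completed to an orthonormal basis, after normalization, at the same index
  have key : ∀ z : E, ‖z‖ = ‖x‖ →
      ∃ b : OrthonormalBasis (Fin (finrank ℂ E)) ℂ E, ∃ i : Fin (finrank ℂ E), i.1 = 0 ∧
        (‖x‖ : ℂ) • b i = z := by
    intro z hz
    have : Nontrivial E := ⟨x, 0, hx⟩
    let i : Fin (finrank ℂ E) := ⟨0, finrank_pos⟩
    obtain ⟨b, hb⟩ := Orthonormal.exists_orthonormalBasis_extension_of_card_eq
      (𝕜 := ℂ) (E := E) (ι := Fin (finrank ℂ E)) (by simp)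
      (v := fun _ => (‖x‖ : ℂ)⁻¹ • z) (s := {i}) (by
        refine ⟨fun j => ?_, fun j k hjk => absurd (Subsingleton.elim j k) hjk⟩
        simp [Set.domRestrict, norm_smul, hz, hx])
    exact ⟨b, i, rfl, by rw [hb i rfl, smul_inv_smul₀ hn]⟩
  obtain ⟨b, i, hi, hbi⟩ := key x rfl
  obtain ⟨c, j, hj, hcj⟩ := key y h.symm
  obtain rfl : i = j := Fin.ext (hi.trans hj.symm)
  refine ⟨b.equiv c (Equiv.refl _), ?_⟩
  conv_lhs => rw [← hbi]
  rw [map_smul, OrthonormalBasis.equiv_apply_basis, Equiv.refl_apply, hcj]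

variable [MeasurableSpace E] [BorelSpace E]

/-- A unitarily invariant probability measure on the unit sphere is unique. Both characteristic
functions equal the same double integral over the two measures, so no group averaging is needed. -/
theorem measure_eq_of_forall_map_linearIsometryEquiv_eq (ρ σ : Measure E)
    [IsProbabilityMeasure ρ] [IsProbabilityMeasure σ]
    (hρ : ∀ᵐ x ∂ρ, ‖x‖ = 1) (hσ : ∀ᵐ x ∂σ, ‖x‖ = 1)
    (hρW : ∀ W : E ≃ₗᵢ[ℂ] E, ρ.map W = ρ) (hσW : ∀ W : E ≃ₗᵢ[ℂ] E, σ.map W = σ) :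
    ρ = σ := by
  have charFun_comp : ∀ τ : Measure E, (∀ W : E ≃ₗᵢ[ℂ] E, τ.map W = τ) →
      ∀ s t : E, ‖s‖ = ‖t‖ → charFun τ s = charFun τ t := by
    intro τ hτ s t hst
    obtain ⟨W, rfl⟩ := exists_linearIsometryEquiv_apply_eq hst
    conv_rhs => rw [← hτ W]
    rw [charFun_apply, charFun_apply, integral_map (by fun_prop)
      (by fun_prop)]
    refine integral_congr_ae (.of_forall fun x => ?_)
    have : inner ℝ (W x) (W s) = inner ℝ x s := by
      change (inner ℂ (W x) (W s)).re = (inner ℂ x s).re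
      rw [W.inner_map_map]
    simp only [this]
  have charFun_average : ∀ τ τ' : Measure E, IsProbabilityMeasure τ' →
      (∀ W : E ≃ₗᵢ[ℂ] E, τ.map W = τ) → (∀ᵐ x ∂τ', ‖x‖ = 1) → ∀ t : E,
      charFun τ t = ∫ y, ∫ x, Complex.exp ((‖t‖ * inner ℝ x y : ℝ) * Complex.I) ∂τ ∂τ' := by
    intro τ τ' _ hτ hτ' t
    have h : (fun y => ∫ x, Complex.exp ((‖t‖ * inner ℝ x y : ℝ) * Complex.I) ∂τ)
        =ᵐ[τ'] fun _ => charFun τ t := by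
      filter_upwards [hτ'] with y hy
      rw [charFun_comp τ hτ t (‖t‖ • y) (by simp [norm_smul, hy]), charFun_apply]
      simp only [inner_smul_right]
    rw [integral_congr_ae h]
    simp
  refine Measure.ext_of_charFun (funext fun t => ?_)
  rw [charFun_average ρ σ inferInstance hρW hσ, charFun_average σ ρ inferInstance hσW hρ,
    integral_integral_swap]
  · simp only [real_inner_comm]
  · refine Integrable.of_bound (C := 1) ?_ (.of_forall fun p => ?_)
    · apply Continuous.aestronglyMeasurable
      unfold Function.uncurry
      fun_prop
    · simp only [Function.uncurry]
      rw [Complex.norm_exp_ofReal_mul_I]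

end Sphere

/-! ### Overlaps of a Gaussian direction -/

section Gaussian

/-- The tail of the Gaussian weight of a real plane, computed in polar coordinates. -/
theorem setLIntegral_exp_neg_norm_sq_of_finrank_eq_two {V : Type*} [NormedAddCommGroup V]
    [InnerProductSpace ℝ V] [FiniteDimensional ℝ V] [MeasurableSpace V] [BorelSpace V]
    (hV : finrank ℝ V = 2) {s : ℝ} (hs : 0 ≤ s) :
    ∫⁻ a in {a : V | s ≤ ‖a‖ ^ 2}, ENNReal.ofReal (Real.exp (-‖a‖ ^ 2))
      = ENNReal.ofReal (Real.pi * Real.exp (-s)) := by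
  have hnt : Nontrivial V := Module.nontrivial_of_finrank_pos (R := ℝ) (by omega)
  have hderiv : ∀ x : ℝ, HasDerivAt (fun r : ℝ => -Real.exp (-r ^ 2) / 2)
      (x * Real.exp (-x ^ 2)) x := by
    intro x
    have := ((((hasDerivAt_id x).pow 2).neg).exp.neg).div_const 2
    convert! this using 1
    simp
    ring
  have htend : Tendsto (fun r : ℝ => -Real.exp (-r ^ 2) / 2) atTop (𝓝 0) := by
    have h : Tendsto (fun r : ℝ => Real.exp (-r ^ 2)) atTop (𝓝 0) :=
      Real.tendsto_exp_neg_atTop_nhds_zero.comp (tendsto_pow_atTop two_ne_zero)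
    simpa using h.neg.div_const 2
  have hray : ∀ u : ℝ, 0 ≤ u →
      ∫ y in Set.Ioi u, y * Real.exp (-y ^ 2) = Real.exp (-u ^ 2) / 2 := by
    intro u hu
    rw [integral_Ioi_of_hasDerivAt_of_tendsto' (fun x _ => hderiv x)
      (integrableOn_Ioi_deriv_of_nonneg' (fun x _ => hderiv x) (fun x hx => ?_) htend) htend]
    · ring
    · have : 0 < x := hu.trans_lt hx
      positivity
  have hfull : ∫ a : V, Real.exp (-‖a‖ ^ 2) = Real.pi := by
    have := GaussianFourier.integral_rexp_neg_mul_sq_norm (V := V) one_pos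
    simpa [hV] using this
  have hint : Integrable fun a : V => Real.exp (-‖a‖ ^ 2) := by
    by_contra h
    exact Real.pi_ne_zero (hfull ▸ integral_undef h)
  -- the area of the unit disc, read off from the full Gaussian integral
  have hball : (2 : ℝ) * volume.real (Metric.ball (0 : V) 1) = 2 * Real.pi := by
    have h := integral_fun_norm_addHaar (volume : Measure V) fun r => Real.exp (-r ^ 2)
    rw [hfull, hV] at h
    simp only [Nat.add_one_sub_one, pow_one, smul_eq_mul, hray 0 le_rfl] at h
    simp at h
    linarith
  have hmeas : MeasurableSet {a : V | s ≤ ‖a‖ ^ 2} :=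
    measurableSet_le measurable_const (by fun_prop)
  rw [← ofReal_integral_eq_lintegral_ofReal hint.integrableOn
    (.of_forall fun a => (Real.exp_pos _).le), ← integral_indicator hmeas]
  congr 1
  have h := integral_fun_norm_addHaar (volume : Measure V)
    ({r : ℝ | s ≤ r ^ 2}.indicator fun r => Real.exp (-r ^ 2))
  have hset : ∫ y in Set.Ioi (0 : ℝ) ∩ {r : ℝ | s ≤ r ^ 2}, y * Real.exp (-y ^ 2)
      = ∫ y in Set.Ioi (Real.sqrt s), y * Real.exp (-y ^ 2) := by
    rcases hs.eq_or_lt with rfl | hs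
    · congr 2
      ext r
      simp [sq_nonneg]
    · rw [← integral_Ici_eq_integral_Ioi]
      congr 2
      ext r
      have h0 := Real.sqrt_pos.2 hs
      simp only [Set.mem_inter_iff, Set.mem_Ioi, Set.mem_ofPred_eq, Set.mem_Ici]
      exact ⟨fun h => (Real.sqrt_le_left h.1.le).2 h.2,
        fun h => ⟨h0.trans_le h, (Real.sqrt_le_left (h0.trans_le h).le).1 h⟩⟩
  have hmeas' : MeasurableSet {r : ℝ | s ≤ r ^ 2} :=
    measurableSet_le measurable_const (by fun_prop)
  have hlhs : ∀ a : V, ({a : V | s ≤ ‖a‖ ^ 2}.indicator fun a => Real.exp (-‖a‖ ^ 2)) a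
      = ({r : ℝ | s ≤ r ^ 2}.indicator fun r => Real.exp (-r ^ 2)) ‖a‖ := fun a => rfl
  rw [integral_congr_ae (.of_forall hlhs), h, hV]
  have hrhs : ∀ y : ℝ, y ^ (2 - 1) • ({r : ℝ | s ≤ r ^ 2}.indicator
      fun r => Real.exp (-r ^ 2)) y
      = {r : ℝ | s ≤ r ^ 2}.indicator (fun r => r * Real.exp (-r ^ 2)) y := by
    intro y
    by_cases hy : s ≤ y ^ 2 <;> simp [Set.indicator, hy]
  rw [integral_congr_ae (.of_forall hrhs), setIntegral_indicator hmeas',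
    hset, hray _ (Real.sqrt_nonneg s), Real.sq_sqrt hs]
  simp only [smul_eq_mul, nsmul_eq_mul]
  push_cast
  linear_combination (Real.exp (-s) / 2) * hball

theorem lintegral_exp_neg_mul_norm_sq {V : Type*} [NormedAddCommGroup V]
    [InnerProductSpace ℝ V] [FiniteDimensional ℝ V] [MeasurableSpace V] [BorelSpace V]
    {k : ℕ} (hV : finrank ℝ V = 2 * k) {b : ℝ} (hb : 0 < b) :
    ∫⁻ v : V, ENNReal.ofReal (Real.exp (-b * ‖v‖ ^ 2)) = ENNReal.ofReal ((Real.pi / b) ^ k) := by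
  have h : ∫ v : V, Real.exp (-b * ‖v‖ ^ 2) = (Real.pi / b) ^ k := by
    rw [GaussianFourier.integral_rexp_neg_mul_sq_norm hb, hV]
    push_cast
    rw [mul_div_cancel_left₀ _ two_ne_zero, Real.rpow_natCast]
  rw [← h, ofReal_integral_eq_lintegral_ofReal ?_ (.of_forall fun a => (Real.exp_pos _).le)]
  by_contra hn
  rw [integral_undef hn] at h
  have := Real.pi_pos
  exact absurd h (by positivity)

end Gaussian

section Sphere

attribute [local instance] InnerProductSpace.complexToReal FiniteDimensional.complexToReal

variable {E : Type*} [NormedAddCommGroup E] [InnerProductSpace ℂ E] [FiniteDimensional ℂ E]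
  [MeasurableSpace E] [BorelSpace E]

/-- Complex-linear isometries preserve the volume of the underlying real spaces. -/
theorem LinearIsometryEquiv.measurePreserving_volume_complex {F : Type*} [NormedAddCommGroup F]
    [InnerProductSpace ℂ F] [FiniteDimensional ℂ F] [MeasurableSpace F] [BorelSpace F]
    (W : E ≃ₗᵢ[ℂ] F) : MeasurePreserving W (volume : Measure E) (volume : Measure F) :=
  LinearIsometryEquiv.measurePreserving
    ({ W.toLinearEquiv.restrictScalars ℝ with norm_map' := W.norm_map } : E ≃ₗᵢ[ℝ] F)

/-- The Gaussian weight of the cone of vectors whose component along `n` has squared norm at least `c`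
times that of the orthogonal component: integrating first over the line `ℂ ∙ n` leaves a Gaussian
integral on its orthogonal complement with exponent `1 + c`. -/
theorem setLIntegral_cone_exp_neg_norm_sq {n : E} (hn : ‖n‖ = 1) {c : ℝ} (hc : 0 ≤ c) :
    ∫⁻ z in {z : E | c * (‖z‖ ^ 2 - ‖inner ℂ n z‖ ^ 2) ≤ ‖inner ℂ n z‖ ^ 2},
        ENNReal.ofReal (Real.exp (-‖z‖ ^ 2))
      = ENNReal.ofReal (Real.pi * (Real.pi / (1 + c)) ^ (finrank ℂ E - 1)) := by
  let K : Submodule ℂ E := ℂ ∙ n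
  have hn0 : n ≠ 0 := by
    rintro rfl
    simp at hn
  have hK : finrank ℂ K = 1 := finrank_span_singleton hn0
  have hKo : finrank ℂ Kᗮ = finrank ℂ E - 1 := by
    have := K.finrank_add_finrank_orthogonal
    omega
  have hpair : MeasurePreserving (fun p : K × Kᗮ => (p.1 : E) + (p.2 : E)) := by
    let _ : InnerProductSpace ℝ (WithLp 2 (K × Kᗮ)) := WithLp.instProdInnerProductSpace
    have h1 := WithLp.volume_preserving_toLp K Kᗮ
    have h2 : MeasurePreserving (K.orthogonalDecomposition.symm) :=
      LinearIsometryEquiv.measurePreserving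
        ({ K.orthogonalDecomposition.symm.toLinearEquiv.restrictScalars ℝ with
            norm_map' := K.orthogonalDecomposition.symm.norm_map } :
          WithLp 2 (K × Kᗮ) ≃ₗᵢ[ℝ] E)
    exact h2.comp h1
  have hinner : ∀ p : K × Kᗮ, ‖inner ℂ n ((p.1 : E) + (p.2 : E))‖ = ‖p.1‖ := by
    intro p
    obtain ⟨z, hz⟩ := Submodule.mem_span_singleton.1 p.1.2
    rw [inner_add_right,
      K.inner_right_of_mem_orthogonal (Submodule.mem_span_singleton_self n) p.2.2,
      add_zero, ← hz, Submodule.coe_norm, ← hz, inner_smul_right, norm_mul,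
      inner_self_eq_norm_sq_to_K, hn, norm_smul, hn]
    simp
  have hnorm : ∀ p : K × Kᗮ, ‖(p.1 : E) + (p.2 : E)‖ ^ 2 = ‖p.1‖ ^ 2 + ‖p.2‖ ^ 2 := by
    intro p
    simpa [sq] using norm_add_sq_eq_norm_sq_add_norm_sq_of_inner_eq_zero (𝕜 := ℂ)
      (p.1 : E) (p.2 : E) (K.inner_right_of_mem_orthogonal p.1.2 p.2.2)
  have hmeas : MeasurableSet
      {z : E | c * (‖z‖ ^ 2 - ‖inner ℂ n z‖ ^ 2) ≤ ‖inner ℂ n z‖ ^ 2} :=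
    measurableSet_le (by fun_prop) (by fun_prop)
  have hmeasK : ∀ b : Kᗮ, MeasurableSet {a : K | c * ‖b‖ ^ 2 ≤ ‖a‖ ^ 2} := fun b =>
    measurableSet_le (by fun_prop) (by fun_prop)
  have hF : Measurable ({z : E | c * (‖z‖ ^ 2 - ‖inner ℂ n z‖ ^ 2) ≤ ‖inner ℂ n z‖ ^ 2}.indicator
      fun z => ENNReal.ofReal (Real.exp (-‖z‖ ^ 2))) :=
    Measurable.indicator (by fun_prop) hmeas
  have hpoint : ∀ (b : Kᗮ) (a : K),
      ({z : E | c * (‖z‖ ^ 2 - ‖inner ℂ n z‖ ^ 2) ≤ ‖inner ℂ n z‖ ^ 2}.indicator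
        fun z => ENNReal.ofReal (Real.exp (-‖z‖ ^ 2))) ((a : E) + (b : E))
      = ENNReal.ofReal (Real.exp (-‖b‖ ^ 2)) *
        {a : K | c * ‖b‖ ^ 2 ≤ ‖a‖ ^ 2}.indicator
          (fun a => ENNReal.ofReal (Real.exp (-‖a‖ ^ 2))) a := by
    intro b a
    have hiff : (a : E) + (b : E) ∈
        {z : E | c * (‖z‖ ^ 2 - ‖inner ℂ n z‖ ^ 2) ≤ ‖inner ℂ n z‖ ^ 2}
        ↔ a ∈ {a : K | c * ‖b‖ ^ 2 ≤ ‖a‖ ^ 2} := by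
      rw [Set.mem_ofPred_eq, hinner (a, b), hnorm (a, b), add_sub_cancel_left, Set.mem_ofPred_eq]
    by_cases ha : a ∈ {a : K | c * ‖b‖ ^ 2 ≤ ‖a‖ ^ 2}
    · rw [Set.indicator_of_mem ha, Set.indicator_of_mem (hiff.2 ha), hnorm (a, b), neg_add_rev,
        Real.exp_add, ENNReal.ofReal_mul (Real.exp_pos _).le]
    · rw [Set.indicator_of_notMem ha, Set.indicator_of_notMem (mt hiff.1 ha), mul_zero]
  have hslice : ∀ b : Kᗮ, ∫⁻ a : K,
      ({z : E | c * (‖z‖ ^ 2 - ‖inner ℂ n z‖ ^ 2) ≤ ‖inner ℂ n z‖ ^ 2}.indicator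
        fun z => ENNReal.ofReal (Real.exp (-‖z‖ ^ 2))) ((a : E) + (b : E))
      = ENNReal.ofReal Real.pi * ENNReal.ofReal (Real.exp (-(1 + c) * ‖b‖ ^ 2)) := by
    intro b
    have hdim : finrank ℝ K = 2 := by
      rw [finrank_real_of_complex, hK]
    simp only [hpoint]
    rw [lintegral_const_mul _ (Measurable.indicator (by fun_prop) (hmeasK b)),
      lintegral_indicator (hmeasK b),
      setLIntegral_exp_neg_norm_sq_of_finrank_eq_two hdim (by positivity),
      ← ENNReal.ofReal_mul (Real.exp_pos _).le, ← ENNReal.ofReal_mul Real.pi_pos.le]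
    congr 1
    rw [mul_left_comm, ← Real.exp_add]
    ring_nf
  have hF' : Measurable fun p : K × Kᗮ =>
      ({z : E | c * (‖z‖ ^ 2 - ‖inner ℂ n z‖ ^ 2) ≤ ‖inner ℂ n z‖ ^ 2}.indicator
        fun z => ENNReal.ofReal (Real.exp (-‖z‖ ^ 2))) ((p.1 : E) + (p.2 : E)) :=
    hF.comp (by fun_prop)
  have hdim' : finrank ℝ Kᗮ = 2 * (finrank ℂ E - 1) := by
    rw [finrank_real_of_complex, hKo]
  rw [← lintegral_indicator hmeas, ← hpair.lintegral_comp hF, Measure.volume_eq_prod,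
    lintegral_prod_symm' _ hF']
  simp only [hslice]
  rw [lintegral_const_mul _ (by fun_prop),
    lintegral_exp_neg_mul_norm_sq hdim' (by positivity), ← ENNReal.ofReal_mul Real.pi_pos.le]

/-- The unnormalized Gaussian measure, with density `exp (-‖z‖ ^ 2)` with respect to volume. -/
def gaussianWeight (E : Type*) [NormedAddCommGroup E] [InnerProductSpace ℂ E]
    [FiniteDimensional ℂ E] [MeasurableSpace E] [BorelSpace E] : Measure E :=
  (volume : Measure E).withDensity fun z => ENNReal.ofReal (Real.exp (-‖z‖ ^ 2))

theorem gaussianWeight_apply {s : Set E} (hs : MeasurableSet s) :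
    gaussianWeight E s = ∫⁻ z in s, ENNReal.ofReal (Real.exp (-‖z‖ ^ 2)) :=
  withDensity_apply _ hs

theorem gaussianWeight_map (W : E ≃ₗᵢ[ℂ] E) : (gaussianWeight E).map W = gaussianWeight E := by
  ext s hs
  have hW := LinearIsometryEquiv.measurePreserving_volume_complex W
  rw [Measure.map_apply W.continuous.measurable hs,
    gaussianWeight_apply (W.continuous.measurable hs), gaussianWeight_apply hs,
    ← hW.setLIntegral_comp_preimage hs (by fun_prop)]
  simp

theorem gaussianWeight_univ {n : E} (hn : ‖n‖ = 1) :
    gaussianWeight E Set.univ = ENNReal.ofReal (Real.pi * Real.pi ^ (finrank ℂ E - 1)) := by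
  have h := setLIntegral_cone_exp_neg_norm_sq hn le_rfl
  have huniv : {z : E | 0 * (‖z‖ ^ 2 - ‖inner ℂ n z‖ ^ 2) ≤ ‖inner ℂ n z‖ ^ 2} = Set.univ :=
    Set.eq_univ_of_forall fun z => by
      rw [Set.mem_ofPred_eq, zero_mul]
      positivity
  rw [huniv, add_zero, div_one] at h
  rw [gaussianWeight_apply MeasurableSet.univ, h]

/-- The law of the direction `z / ‖z‖` of a Gaussian vector `z`. The null vector, which has no
direction, is sent to `0`; it has weight zero in positive dimension. -/
def gaussianDirection (E : Type*) [NormedAddCommGroup E] [InnerProductSpace ℂ E]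
    [FiniteDimensional ℂ E] [MeasurableSpace E] [BorelSpace E] : Measure E :=
  (gaussianWeight E Set.univ)⁻¹ • (gaussianWeight E).map fun z => (‖z‖⁻¹ : ℂ) • z

theorem gaussianDirection_map (W : E ≃ₗᵢ[ℂ] E) :
    (gaussianDirection E).map W = gaussianDirection E := by
  have hu : Measurable fun z : E => (‖z‖⁻¹ : ℂ) • z := by fun_prop
  have hW : Measurable W := W.continuous.measurable
  rw [gaussianDirection, Measure.map_smul, Measure.map_map hW hu]
  congr 1
  conv_rhs => rw [← gaussianWeight_map W, Measure.map_map hu hW]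
  congr 1
  ext z
  simp

theorem isProbabilityMeasure_gaussianDirection {n : E} (hn : ‖n‖ = 1) :
    IsProbabilityMeasure (gaussianDirection E) := by
  refine ⟨?_⟩
  have hpi : 0 < Real.pi * Real.pi ^ (finrank ℂ E - 1) := by have := Real.pi_pos; positivity
  rw [gaussianDirection, Measure.smul_apply, Measure.map_apply (by fun_prop) MeasurableSet.univ,
    Set.preimage_univ, gaussianWeight_univ hn, smul_eq_mul]
  exact ENNReal.inv_mul_cancel (by simpa using hpi) ENNReal.ofReal_ne_top

theorem ae_ne_zero_gaussianWeight {n : E} (hn : ‖n‖ = 1) : ∀ᵐ z ∂gaussianWeight E, z ≠ 0 := by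
  have : Nontrivial E := ⟨n, 0, by rintro rfl; simp at hn⟩
  refine (withDensity_absolutelyContinuous _ _).ae_le ?_
  exact Measure.ae_ne volume 0

theorem ae_norm_eq_one_gaussianDirection {n : E} (hn : ‖n‖ = 1) :
    ∀ᵐ x ∂gaussianDirection E, ‖x‖ = 1 := by
  refine Measure.ae_smul_measure ?_ _
  rw [ae_map_iff (by fun_prop) (measurableSet_eq_fun (by fun_prop) (by fun_prop))]
  filter_upwards [ae_ne_zero_gaussianWeight hn] with z hz
  simp [norm_smul, hz]

/-- For `t < 1`, the condition `t ≤ ‖⟪n, z / ‖z‖⟫‖ ^ 2` describes the cone with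
`c = t / (1 - t)`. -/
theorem gaussianDirection_real_le_norm_inner_sq {n : E} (hn : ‖n‖ = 1) {t : ℝ} (ht0 : 0 ≤ t)
    (ht1 : t < 1) :
    (gaussianDirection E).real {x | t ≤ ‖inner ℂ n x‖ ^ 2} = (1 - t) ^ (finrank ℂ E - 1) := by
  have hc : 0 ≤ t / (1 - t) := div_nonneg ht0 (by linarith)
  have hcone : MeasurableSet
      {z : E | t / (1 - t) * (‖z‖ ^ 2 - ‖inner ℂ n z‖ ^ 2) ≤ ‖inner ℂ n z‖ ^ 2} :=
    measurableSet_le (by fun_prop) (by fun_prop)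
  have hcongr : gaussianWeight E
        ((fun z : E => (‖z‖⁻¹ : ℂ) • z) ⁻¹' {x | t ≤ ‖inner ℂ n x‖ ^ 2})
      = gaussianWeight E
        {z : E | t / (1 - t) * (‖z‖ ^ 2 - ‖inner ℂ n z‖ ^ 2) ≤ ‖inner ℂ n z‖ ^ 2} := by
    apply measure_congr
    rw [Filter.eventuallyEq_set]
    filter_upwards [ae_ne_zero_gaussianWeight hn] with z hz
    have hz' : 0 < ‖z‖ ^ 2 := by positivity
    have h1t : 0 < 1 - t := by linarith
    simp only [Set.mem_preimage, Set.mem_ofPred_eq, inner_smul_right, norm_mul, norm_inv,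
      Complex.norm_real, norm_norm, mul_pow, inv_pow]
    rw [inv_mul_eq_div, le_div_iff₀ hz', div_mul_eq_mul_div, div_le_iff₀ h1t]
    constructor <;> intro h <;> linarith
  have hpi := Real.pi_pos
  rw [measureReal_def, gaussianDirection, Measure.smul_apply,
    Measure.map_apply (by fun_prop) (measurableSet_le (by fun_prop) (by fun_prop)), hcongr,
    gaussianWeight_apply hcone, setLIntegral_cone_exp_neg_norm_sq hn hc, gaussianWeight_univ hn,
    smul_eq_mul, ENNReal.toReal_mul, ENNReal.toReal_inv,
    ENNReal.toReal_ofReal (by positivity), ENNReal.toReal_ofReal (by positivity)]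
  have h1t : 1 - t ≠ 0 := by linarith
  have : Real.pi / (1 + t / (1 - t)) = Real.pi * (1 - t) := by
    field_simp
    simp
  rw [this, mul_pow]
  field_simp

/-- The tail of the squared overlap with a unit vector, under any unitarily invariant law on the
unit sphere. -/
theorem measureReal_le_norm_inner_sq (σ : Measure E) [IsProbabilityMeasure σ]
    (hσ : ∀ᵐ x ∂σ, ‖x‖ = 1) (hσW : ∀ W : E ≃ₗᵢ[ℂ] E, σ.map W = σ) {n : E} (hn : ‖n‖ = 1)
    {t : ℝ} (ht : t ∈ Set.Icc (0 : ℝ) 1) :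
    σ.real {x | t ≤ ‖inner ℂ n x‖ ^ 2} = (1 - t) ^ (finrank ℂ E - 1) := by
  have hlt : ∀ s : ℝ, 0 ≤ s → s < 1 →
      σ.real {x | s ≤ ‖inner ℂ n x‖ ^ 2} = (1 - s) ^ (finrank ℂ E - 1) := by
    intro s hs0 hs1
    have := isProbabilityMeasure_gaussianDirection hn
    rw [measure_eq_of_forall_map_linearIsometryEquiv_eq σ (gaussianDirection E) hσ
      (ae_norm_eq_one_gaussianDirection hn) hσW gaussianDirection_map]
    exact gaussianDirection_real_le_norm_inner_sq hn hs0 hs1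
  rcases ht.2.lt_or_eq with ht1 | rfl
  · exact hlt t ht.1 ht1
  rcases Nat.eq_zero_or_pos (finrank ℂ E - 1) with hd | hd
  · -- in dimension one `‖⟪n, x⟫‖ = ‖x‖`
    have hn0 : n ≠ 0 := by rintro rfl; simp at hn
    have : Nontrivial E := ⟨n, 0, hn0⟩
    have hdim : finrank ℂ E = 1 := by have := finrank_pos (R := ℂ) (M := E); omega
    have hae : ∀ᵐ x ∂σ, x ∈ {x | 1 ≤ ‖inner ℂ n x‖ ^ 2} := by
      filter_upwards [hσ] with x hx
      obtain ⟨c, rfl⟩ := (finrank_eq_one_iff_of_nonzero' n hn0).1 hdim x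
      rw [norm_smul, hn, mul_one] at hx
      rw [inner_smul_right, inner_self_eq_norm_sq_to_K, hn, norm_mul, hx]
      simp
    have hmeas : MeasurableSet {x : E | 1 ≤ ‖inner ℂ n x‖ ^ 2} :=
      measurableSet_le measurable_const (by fun_prop)
    rw [measureReal_def, (mem_ae_iff_prob_eq_one hmeas).1 hae, hd]
    simp
  · -- the value at `t = 1` is squeezed by those at `s < 1`
    have hle : ∀ᶠ s in 𝓝[<] (1 : ℝ),
        σ.real {x | 1 ≤ ‖inner ℂ n x‖ ^ 2} ≤ (1 - s) ^ (finrank ℂ E - 1) := by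
      filter_upwards [Ioo_mem_nhdsLT one_pos] with s hs
      rw [← hlt s hs.1.le hs.2]
      exact measureReal_mono fun x (hx : 1 ≤ _) => hs.2.le.trans hx
    have htend : Tendsto (fun s : ℝ => (1 - s) ^ (finrank ℂ E - 1)) (𝓝[<] 1)
        (𝓝 ((1 - 1) ^ (finrank ℂ E - 1))) :=
      ((continuous_const.sub continuous_id).pow _).continuousAt.tendsto.mono_left
        nhdsWithin_le_nhds
    refine le_antisymm (ge_of_tendsto htend hle) ?_
    rw [sub_self, zero_pow hd.ne']
    exact measureReal_nonneg

end Sphere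

/-! ### The Beta law and the surface measure -/

/-- The tail of the `Beta(1, m)` law, whose density is `m (1 - x) ^ (m - 1)` on `(0, 1)`. -/
theorem betaMeasure_one_natCast_Ici {m : ℕ} (hm : 0 < m) {a : ℝ} (ha : a ∈ Set.Icc (0 : ℝ) 1) :
    betaMeasure 1 m (Set.Ici a) = ENNReal.ofReal ((1 - a) ^ m) := by
  have hm' : (0 : ℝ) < m := by exact_mod_cast hm
  have hbeta : 1 / beta 1 m = m := by
    rw [beta, add_comm, Real.Gamma_add_one hm'.ne', Real.Gamma_one]
    have := (Real.Gamma_pos_of_pos hm').ne'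
    field_simp
  -- the null point `a` is left out, so that `0 < x` also holds when `a = 0`
  have hpdf : ∀ᵐ x : ℝ, (Set.Ici a).indicator (betaPDF 1 m) x
      = (Set.Ioo a 1).indicator (fun x => ENNReal.ofReal (m * (1 - x) ^ (m - 1))) x := by
    filter_upwards [Measure.ae_ne volume a] with x hx
    rcases lt_or_ge x a with hxa | hxa
    · rw [Set.indicator_of_notMem (by simpa using hxa),
        Set.indicator_of_notMem (fun h : x ∈ Set.Ioo a 1 => hxa.not_gt h.1)]
    have hax : a < x := lt_of_le_of_ne hxa (Ne.symm hx)
    rcases lt_or_ge x 1 with hx1 | hx1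
    · rw [Set.indicator_of_mem (Set.mem_Ici.2 hxa),
        Set.indicator_of_mem (Set.mem_Ioo.2 ⟨hax, hx1⟩),
        betaPDF_of_pos_lt_one (ha.1.trans_lt hax) hx1, hbeta,
        sub_self, Real.rpow_zero, mul_one, ← Nat.cast_pred hm, Real.rpow_natCast]
    · rw [Set.indicator_of_mem (Set.mem_Ici.2 hxa),
        Set.indicator_of_notMem (fun h : x ∈ Set.Ioo a 1 => hx1.not_gt h.2),
        betaPDF_eq_zero_of_one_le hx1]
  have hderiv : ∀ x : ℝ, HasDerivAt (fun x : ℝ => -(1 - x) ^ m) (m * (1 - x) ^ (m - 1)) x := by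
    intro x
    have := ((((hasDerivAt_id x).const_sub 1)).pow m).neg
    convert! this using 1
    simp
  have hcont : Continuous fun x : ℝ => (m : ℝ) * (1 - x) ^ (m - 1) := by fun_prop
  rw [betaMeasure, withDensity_apply _ measurableSet_Ici, ← lintegral_indicator measurableSet_Ici,
    lintegral_congr_ae hpdf, lintegral_indicator measurableSet_Ioo,
    ← ofReal_integral_eq_lintegral_ofReal]
  · rw [← integral_Ioc_eq_integral_Ioo, ← intervalIntegral.integral_of_le ha.2,
      intervalIntegral.integral_eq_sub_of_hasDerivAt (fun x _ => hderiv x)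
        (hcont.intervalIntegrable _ _)]
    simp [hm.ne']
  · exact (hcont.integrableOn_Icc (a := a) (b := 1)).mono_set Set.Ioo_subset_Icc_self
  · refine ae_restrict_of_forall_mem measurableSet_Ioo fun x hx => ?_
    have : 0 ≤ 1 - x := by linarith [hx.2]
    positivity

theorem betaOneLaw_Ici {g : ℕ} (hg : 0 < g) {a : ℝ} (ha : a ∈ Set.Icc (0 : ℝ) 1) :
    betaOneLaw g (Set.Ici a) = ENNReal.ofReal ((1 - a) ^ (g - 1)) := by
  unfold betaOneLaw
  split_ifs with h
  · subst h
    simp [ha.2]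
  · rw [← Nat.cast_pred hg]
    exact betaMeasure_one_natCast_Ici (by omega) ha

theorem isProbabilityMeasure_betaOneLaw {g : ℕ} (hg : 0 < g) :
    IsProbabilityMeasure (betaOneLaw g) := by
  unfold betaOneLaw
  split_ifs with h
  · infer_instance
  · refine isProbabilityMeasureBeta one_pos ?_
    rw [← Nat.cast_pred hg]
    exact_mod_cast (by omega : 0 < g - 1)

/-- A law bounded by `1` with tail `(1 - t) ^ (g - 1)` on `[0, 1]` is `Beta(1, g - 1)`. -/
theorem eq_betaOneLaw {g : ℕ} (hg : 0 < g) (ρ : Measure ℝ) [IsProbabilityMeasure ρ]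
    (hρ : ∀ᵐ x ∂ρ, x ≤ 1)
    (htail : ∀ t ∈ Set.Icc (0 : ℝ) 1, ρ.real (Set.Ici t) = (1 - t) ^ (g - 1)) :
    ρ = betaOneLaw g := by
  have := isProbabilityMeasure_betaOneLaw hg
  have hIcc : ∀ t ∈ Set.Icc (0 : ℝ) 1, ρ (Set.Ici t) = betaOneLaw g (Set.Ici t) := fun t ht => by
    rw [betaOneLaw_Ici hg ht, ← htail t ht, ofReal_measureReal]
  have hIci : ∀ (τ : Measure ℝ), IsProbabilityMeasure τ → τ (Set.Ici 0) = 1 → ∀ a ≤ 0,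
      τ (Set.Ici a) = 1 := fun τ _ h a ha =>
    le_antisymm prob_le_one (h ▸ measure_mono (Set.Ici_subset_Ici.2 ha))
  have h0 : betaOneLaw g (Set.Ici 0) = 1 := by
    rw [betaOneLaw_Ici hg ⟨le_rfl, zero_le_one⟩]
    simp
  refine Measure.ext_of_Ici _ _ fun a => ?_
  rcases le_total a 0 with ha0 | ha0
  · rw [hIci ρ inferInstance ((hIcc 0 ⟨le_rfl, zero_le_one⟩).trans h0) a ha0,
      hIci _ inferInstance h0 a ha0]
  rcases le_or_gt a 1 with ha1 | ha1
  · exact hIcc a ⟨ha0, ha1⟩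
  · have hleft : ρ (Set.Ici a) = 0 := by
      refine measure_mono_null (fun x hx => ?_) (ae_iff.1 hρ)
      exact not_le.2 (ha1.trans_le hx)
    have hright : betaOneLaw g (Set.Ici a) = 0 := by
      unfold betaOneLaw
      split_ifs with h
      · simp [ha1]
      · rw [betaMeasure, withDensity_apply _ measurableSet_Ici]
        exact setLIntegral_eq_zero measurableSet_Ici fun x hx =>
          betaPDF_eq_zero_of_one_le (ha1.le.trans hx)
    rw [hleft, hright]

section Sphere
attribute [local instance] InnerProductSpace.complexToReal FiniteDimensional.complexToReal
open scoped Pointwise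

variable {E : Type*} [NormedAddCommGroup E] [InnerProductSpace ℂ E] [FiniteDimensional ℂ E]
  [MeasurableSpace E] [BorelSpace E]

theorem isProbabilityMeasure_uniformSphere [Nontrivial E] :
    IsProbabilityMeasure (uniformSphere E) := by
  refine ⟨?_⟩
  rw [uniformSphere, Measure.smul_apply, smul_eq_mul]
  exact ENNReal.inv_mul_cancel (Measure.measure_univ_ne_zero.2 (Measure.toSphere_ne_zero _))
    (measure_ne_top _ _)

/-- The surface measure is unitarily invariant, since the cone over a set rotates with the set. -/
theorem uniformSphere_map_coe_map (W : E ≃ₗᵢ[ℂ] E) :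
    ((uniformSphere E).map (Subtype.val : Metric.sphere (0 : E) 1 → E)).map W
      = (uniformSphere E).map (Subtype.val : Metric.sphere (0 : E) 1 → E) := by
  have hW : Measurable W := W.continuous.measurable
  ext s hs
  rw [Measure.map_apply hW hs, Measure.map_apply measurable_subtype_coe (hW hs),
    Measure.map_apply measurable_subtype_coe hs, uniformSphere, Measure.smul_apply,
    Measure.smul_apply, Measure.toSphere_apply' _ (measurable_subtype_coe (hW hs)),
    Measure.toSphere_apply' _ (measurable_subtype_coe hs)]
  congr 2
  have hcone : Set.Ioo (0 : ℝ) 1 • (Subtype.val '' (Subtype.val ⁻¹' (W ⁻¹' s) :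
        Set (Metric.sphere (0 : E) 1)))
      = W ⁻¹' (Set.Ioo (0 : ℝ) 1 • (Subtype.val '' (Subtype.val ⁻¹' s :
        Set (Metric.sphere (0 : E) 1)))) := by
    have hmap : ∀ (r : ℝ) (x : E), W (r • x) = r • W x := fun r x => by
      rw [← Complex.coe_smul, map_smul, Complex.coe_smul]
    ext x
    simp only [Set.mem_smul, Subtype.image_preimage_coe, Set.mem_inter_iff, Set.mem_preimage,
      mem_sphere_zero_iff_norm]
    constructor
    · rintro ⟨r, hr, y, ⟨hy, hys⟩, rfl⟩
      exact ⟨r, hr, W y, ⟨by rwa [W.norm_map], hys⟩, (hmap r y).symm⟩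
    · rintro ⟨r, hr, y, ⟨hy, hys⟩, hxy⟩
      refine ⟨r, hr, W.symm y, ⟨by rwa [W.symm.norm_map], by simpa using hys⟩, ?_⟩
      apply W.injective
      rw [hmap, W.apply_symm_apply, hxy]
  rw [hcone]
  exact (LinearIsometryEquiv.measurePreserving_volume_complex W).measure_preimage_emb
    W.toHomeomorph.measurableEmbedding _

theorem ae_norm_eq_one_uniformSphere :
    ∀ᵐ x ∂(uniformSphere E).map (Subtype.val : Metric.sphere (0 : E) 1 → E), ‖x‖ = 1 := by
  rw [ae_map_iff measurable_subtype_coe.aemeasurable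
    (measurableSet_eq_fun (by fun_prop) (by fun_prop))]
  exact .of_forall fun x => by simp

/-- The normalized surface measure is the only unitarily invariant law on the unit sphere. -/
theorem eq_uniformSphere_map_coe [Nontrivial E] (σ : Measure E) [IsProbabilityMeasure σ]
    (hσ : ∀ᵐ x ∂σ, ‖x‖ = 1) (hσW : ∀ W : E ≃ₗᵢ[ℂ] E, σ.map W = σ) :
    σ = (uniformSphere E).map (Subtype.val : Metric.sphere (0 : E) 1 → E) := by
  have := isProbabilityMeasure_uniformSphere (E := E)
  have := Measure.isProbabilityMeasure_map (μ := uniformSphere E)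
    measurable_subtype_coe.aemeasurable
  exact measure_eq_of_forall_map_linearIsometryEquiv_eq _ _ hσ ae_norm_eq_one_uniformSphere hσW
    uniformSphere_map_coe_map

end Sphere

/-! ### Equivariance of the ground direction -/

theorem act_mul {N : ℕ} (A B : CMat N) (x : Hilb N) : act (A * B) x = act A (act B x) := by
  simp [act, Matrix.toLpLin_apply, Matrix.mulVec_mulVec]

/-- The action of a unitary matrix on `ℂ^N`, as a linear isometry. -/
def unitaryIsometry {N : ℕ} (R : UN N) : Hilb N ≃ₗᵢ[ℂ] Hilb N :=
  Unitary.linearIsometryEquiv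
    ⟨Matrix.toEuclideanCLM (𝕜 := ℂ) (n := Fin N) (R : CMat N),
      Unitary.map_mem (Matrix.toEuclideanCLM (𝕜 := ℂ) (n := Fin N)) R.2⟩

theorem unitaryIsometry_apply {N : ℕ} (R : UN N) (x : Hilb N) :
    unitaryIsometry R x = act (R : CMat N) x := rfl

theorem act_conjTranspose_act {N : ℕ} (R : UN N) (x : Hilb N) :
    act (R : CMat N).conjTranspose (act (R : CMat N) x) = x := by
  rw [← act_mul, ← Matrix.star_eq_conjTranspose, Unitary.star_mul_self_of_mem R.2]
  simp [act]

theorem act_act_conjTranspose {N : ℕ} (R : UN N) (x : Hilb N) :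
    act (R : CMat N) (act (R : CMat N).conjTranspose x) = x := by
  rw [← act_mul, ← Matrix.star_eq_conjTranspose, Unitary.mul_star_self_of_mem R.2]
  simp [act]

theorem unitaryIsometry_symm_apply {N : ℕ} (R : UN N) (x : Hilb N) :
    (unitaryIsometry R).symm x = act (R : CMat N).conjTranspose x := by
  rw [LinearIsometryEquiv.symm_apply_eq, unitaryIsometry_apply, act_act_conjTranspose]

/-- Every linear isometry of `ℂ^N` is the action of a unitary matrix. -/
theorem exists_unitaryGroup_act_eq {N : ℕ} (e : Hilb N ≃ₗᵢ[ℂ] Hilb N) :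
    ∃ W : UN N, ∀ x, act (W : CMat N) x = e x := by
  let f := Matrix.toEuclideanCLM (𝕜 := ℂ) (n := Fin N)
  refine ⟨⟨f.symm (Unitary.linearIsometryEquiv.symm e : Hilb N →L[ℂ] Hilb N),
    Unitary.map_mem f.symm (Unitary.linearIsometryEquiv.symm e).2⟩, fun x => ?_⟩
  change f (f.symm (Unitary.linearIsometryEquiv.symm e : Hilb N →L[ℂ] Hilb N)) x = e x
  rw [f.apply_symm_apply]
  rfl

theorem mem_energySpace_iff {N : ℕ} {K : CMat N} {E₀ : ℝ} {x : Hilb N} :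
    x ∈ energySpace K E₀ ↔ act K x = (E₀ : ℂ) • x :=
  End.mem_eigenspace_iff

/-- The eigenspace of `R† H R` is `R†` applied to that of `H`. -/
theorem energySpace_rotated {N : ℕ} (H : CMat N) (E₀ : ℝ) (R : UN N) :
    energySpace (rotated H R) E₀
      = (energySpace H E₀).map ((unitaryIsometry R).symm.toLinearEquiv : Hilb N →ₗ[ℂ] Hilb N) := by
  ext x
  rw [Submodule.mem_map_equiv]
  change _ ↔ act (R : CMat N) x ∈ _
  rw [mem_energySpace_iff, mem_energySpace_iff, rotated, act_mul, act_mul]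
  constructor
  · intro h
    have := congrArg (unitaryIsometry R) h
    rwa [map_smul, unitaryIsometry_apply, unitaryIsometry_apply, act_act_conjTranspose] at this
  · intro h
    rw [h, ← unitaryIsometry_symm_apply, map_smul, unitaryIsometry_symm_apply,
      act_conjTranspose_act]

theorem starProjection_energySpace_rotated {N : ℕ} (H : CMat N) (E₀ : ℝ) (R : UN N)
    (x : Hilb N) :
    (energySpace (rotated H R) E₀).starProjection x
      = (unitaryIsometry R).symm ((energySpace H E₀).starProjection (act (R : CMat N) x)) := by
  simp only [energySpace_rotated]
  rw [Submodule.starProjection_map_apply, LinearIsometryEquiv.symm_symm, unitaryIsometry_apply]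

section
variable {N : ℕ} {Ω : Type*} (H : CMat N) (E₀ : ℝ) (prep : Ω → CMat N → Hilb N)

/-- The component `Π_𝓖 R φ̃` of the rotated output `R φ̃` of the preparation rule in the ground
space, as an element of `𝓖`. -/
def groundOutput (R : UN N) (w : Ω) : energySpace H E₀ :=
  (energySpace H E₀).orthogonalProjectionOnto (act (R : CMat N) (prep w (rotated H R)))

/-- The normalized ground component, as an element of `𝓖`; it is `0` where the component
vanishes. -/
def groundDirection (R : UN N) (w : Ω) : energySpace H E₀ :=
  (‖groundOutput H E₀ prep R w‖⁻¹ : ℂ) • groundOutput H E₀ prep R w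

/-- Projecting onto `R†𝓖` and rotating by `R` amounts to rotating by `R` and projecting onto `𝓖`. -/
theorem normalizedFootPoint_eq (R : UN N) (w : Ω) :
    normalizedFootPoint (footPoint H E₀ prep) R w = (groundDirection H E₀ prep R w : Hilb N) := by
  have hnormalize : ∀ x : Hilb N, NormedSpace.normalize x = (‖x‖⁻¹ : ℂ) • x := by
    intro x
    rw [NormedSpace.normalize, ← Complex.ofReal_inv, Complex.coe_smul]
  have hfoot : footPoint H E₀ prep R w
      = NormedSpace.normalize (groundOutput H E₀ prep R w : Hilb N) := by
    rw [footPoint, groundComponent, starProjection_energySpace_rotated, hnormalize, hnormalize,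
      LinearIsometryEquiv.norm_map, ← unitaryIsometry_apply, map_smul,
      LinearIsometryEquiv.apply_symm_apply]
    rfl
  rw [normalizedFootPoint, hfoot, NormedSpace.normalize_normalize, hnormalize]
  rfl

theorem groundOutput_ne_zero_iff (R : UN N) (w : Ω) :
    groundOutput H E₀ prep R w ≠ 0 ↔
      (energySpace (rotated H R) E₀).starProjection (prep w (rotated H R)) ≠ 0 := by
  rw [starProjection_energySpace_rotated, Ne, Ne, LinearIsometryEquiv.map_eq_zero_iff,
    Submodule.starProjection_apply, Submodule.coe_eq_zero]
  rfl

variable {H E₀ prep}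

theorem norm_groundDirection {R : UN N} {w : Ω} (h : groundOutput H E₀ prep R w ≠ 0) :
    ‖groundDirection H E₀ prep R w‖ = 1 := by
  simp [groundDirection, norm_smul, h]

/-- A unitary of the ground space, extended by the identity on its orthogonal complement, is a
unitary matrix commuting with `H`. -/
theorem exists_unitaryGroup_extend (hH : H.IsHermitian)
    (u : energySpace H E₀ ≃ₗᵢ[ℂ] energySpace H E₀) :
    ∃ W : UN N, (∀ x, act (W : CMat N) (act H x) = act H (act (W : CMat N) x)) ∧
      ∀ x, (energySpace H E₀).orthogonalProjectionOnto (act (W : CMat N) x)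
        = u ((energySpace H E₀).orthogonalProjectionOnto x) := by
  let G := energySpace H E₀
  let L : Hilb N →ₗ[ℂ] Hilb N :=
    G.subtype ∘ₗ u.toLinearEquiv.toLinearMap ∘ₗ G.orthogonalProjectionOnto.toLinearMap
      + Gᗮ.starProjection.toLinearMap
  have hL : ∀ x, L x = (u (G.orthogonalProjectionOnto x) : Hilb N) + Gᗮ.starProjection x :=
    fun x => rfl
  have hproj : ∀ x, G.orthogonalProjectionOnto (L x) = u (G.orthogonalProjectionOnto x) := by
    intro x
    rw [hL, map_add, Submodule.orthogonalProjectionOnto_mem_subspace_eq_self,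
      Submodule.orthogonalProjectionOnto_eq_zero_iff.2
        (Gᗮ.starProjection_apply_mem x), add_zero]
  have hnorm : ∀ x, ‖L x‖ = ‖x‖ := by
    intro x
    have h1 := G.norm_sq_eq_add_norm_sq_starProjection x
    have h2 := norm_add_sq_eq_norm_sq_add_norm_sq_of_inner_eq_zero (𝕜 := ℂ)
      (u (G.orthogonalProjectionOnto x) : Hilb N) (Gᗮ.starProjection x)
      (G.inner_right_of_mem_orthogonal (u (G.orthogonalProjectionOnto x)).2
        (Gᗮ.starProjection_apply_mem x))
    rw [← hL, Submodule.norm_coe, u.norm_map, ← Submodule.norm_coe,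
      ← Submodule.starProjection_apply] at h2
    rw [← sq_eq_sq₀ (norm_nonneg _) (norm_nonneg _), h1]
    simpa [sq] using h2
  let e : Hilb N ≃ₗᵢ[ℂ] Hilb N := LinearIsometry.toLinearIsometryEquiv ⟨L, hnorm⟩ rfl
  obtain ⟨W, hW⟩ := exists_unitaryGroup_act_eq e
  have hWL : ∀ x, act (W : CMat N) x = L x := hW
  have hsymm : ∀ x y, inner ℂ (act H x) y = inner ℂ x (act H y) :=
    Matrix.isSymmetric_toEuclideanLin_iff.2 hH
  have hadd : ∀ x y, act H (x + y) = act H x + act H y := map_add (Matrix.toEuclideanLin H)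
  have hG : ∀ x : G, act H x = (E₀ : ℂ) • (x : Hilb N) := fun x => mem_energySpace_iff.1 x.2
  have hdecomp : ∀ x, (G.orthogonalProjectionOnto x : Hilb N) + Gᗮ.starProjection x = x :=
    fun x => G.starProjection_add_starProjection_orthogonal x
  have hperp : ∀ y ∈ Gᗮ, act H y ∈ Gᗮ := by
    intro y hy
    rw [Submodule.mem_orthogonal] at hy ⊢
    intro v hv
    rw [← hsymm, hG ⟨v, hv⟩, inner_smul_left, hy v hv, mul_zero]
  have hHx : ∀ x, act H x = ((E₀ : ℂ) • G.orthogonalProjectionOnto x : G)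
      + act H (Gᗮ.starProjection x) := by
    intro x
    conv_lhs => rw [← hdecomp x, hadd, hG]
    rfl
  have hPH : ∀ x, G.orthogonalProjectionOnto (act H x)
      = (E₀ : ℂ) • G.orthogonalProjectionOnto x := by
    intro x
    rw [hHx, map_add, Submodule.orthogonalProjectionOnto_mem_subspace_eq_self,
      Submodule.orthogonalProjectionOnto_eq_zero_iff.2
        (hperp _ (Gᗮ.starProjection_apply_mem x)), add_zero]
  have hQH : ∀ x, Gᗮ.starProjection (act H x) = act H (Gᗮ.starProjection x) := by
    intro x
    have h1 := hdecomp (act H x)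
    rw [hPH] at h1
    exact add_left_cancel (h1.trans (hHx x))
  refine ⟨W, fun x => ?_, fun x => by rw [hWL]; exact hproj x⟩
  rw [hWL, hWL, hL, hL, hadd, hPH, hQH, hG, map_smul]
  rfl

/-- Rotations that differ by a symmetry of `H` on the left produce the same Hamiltonian. -/
theorem rotated_mul {W : UN N}
    (hW : ∀ x, act (W : CMat N) (act H x) = act H (act (W : CMat N) x)) (R : UN N) :
    rotated H (W * R) = rotated H R := by
  have hcomm : (W : CMat N) * H = H * (W : CMat N) := by
    apply Matrix.toEuclideanLin.injective
    ext1 x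
    change act _ x = act _ x
    rw [act_mul, act_mul, hW]
  have hWW : (W : CMat N).conjTranspose * (W : CMat N) = 1 := by
    rw [← Matrix.star_eq_conjTranspose, Unitary.star_mul_self_of_mem W.2]
  rw [rotated, rotated, Submonoid.coe_mul, Matrix.conjTranspose_mul]
  calc _ = (R : CMat N).conjTranspose * ((W : CMat N).conjTranspose * (H * (W : CMat N)))
        * (R : CMat N) := by simp only [mul_assoc]
    _ = _ := by rw [← hcomm, ← mul_assoc (W : CMat N).conjTranspose, hWW, one_mul]

/-- Every unitary of the ground space is realized on ground directions by a left translation of the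
rotation, the same one for all values of the internal randomness. -/
theorem exists_unitaryGroup_groundDirection_mul (hH : H.IsHermitian)
    (u : energySpace H E₀ ≃ₗᵢ[ℂ] energySpace H E₀) :
    ∃ W : UN N, ∀ (R : UN N) (w : Ω),
      groundDirection H E₀ prep (W * R) w = u (groundDirection H E₀ prep R w) := by
  obtain ⟨W, hcomm, hproj⟩ := exists_unitaryGroup_extend hH u
  refine ⟨W, fun R w => ?_⟩
  have hout : groundOutput H E₀ prep (W * R) w = u (groundOutput H E₀ prep R w) := by
    rw [groundOutput, rotated_mul hcomm, Submonoid.coe_mul, act_mul, hproj]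
    rfl
  rw [groundDirection, hout, u.norm_map, ← map_smul]
  rfl

theorem continuous_coe_apply (i j : Fin N) : Continuous fun R : UN N => (R : CMat N) i j :=
  (continuous_apply_apply i j).comp continuous_subtype_val

theorem measurable_groundOutput [MeasurableSpace Ω]
    (hprep : Measurable fun p : UN N × Ω => prep p.2 (rotated H p.1)) :
    Measurable fun p : UN N × Ω => groundOutput H E₀ prep p.1 p.2 := by
  refine (energySpace H E₀).orthogonalProjectionOnto.continuous.measurable.comp ?_
  refine (WithLp.measurable_toLp 2 _).comp (measurable_pi_iff.2 fun k => ?_)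
  change Measurable fun p : UN N × Ω =>
    ∑ j, (p.1 : CMat N) k j * (prep p.2 (rotated H p.1)) j
  refine Finset.measurable_sum _ fun j _ => ?_
  have h1 : Measurable fun p : UN N × Ω => (p.1 : CMat N) k j :=
    (continuous_coe_apply k j).measurable.comp measurable_fst
  have h2 : Measurable fun p : UN N × Ω => (prep p.2 (rotated H p.1)) j :=
    (measurable_pi_apply j).comp ((WithLp.measurable_ofLp 2 _).comp hprep)
  exact h1.mul h2

theorem measurable_groundDirection [MeasurableSpace Ω]
    (hprep : Measurable fun p : UN N × Ω => prep p.2 (rotated H p.1)) :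
    Measurable fun p : UN N × Ω => groundDirection H E₀ prep p.1 p.2 := by
  have h := measurable_groundOutput (E₀ := E₀) hprep
  exact (Complex.measurable_ofReal.comp h.norm).inv.smul h

theorem measurable_groundDirection_left [MeasurableSpace Ω]
    (hprep : Measurable fun p : UN N × Ω => prep p.2 (rotated H p.1)) (w : Ω) :
    Measurable fun R : UN N => groundDirection H E₀ prep R w := by
  have h : Measurable fun R : UN N => (R, w) := measurable_id.prodMk measurable_const
  have h' := (measurable_groundDirection (E₀ := E₀) hprep).comp h
  exact h'

instance instIsHaarMeasureUnitaryHaar (N : ℕ) : (unitaryHaar N).IsHaarMeasure := by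
  unfold unitaryHaar
  infer_instance

/-- For fixed internal randomness, the ground direction of a Haar rotation is uniform. -/
theorem map_groundDirection_eq_uniform [MeasurableSpace Ω] [Nontrivial (energySpace H E₀)]
    (hH : H.IsHermitian)
    (hprep : Measurable fun p : UN N × Ω => prep p.2 (rotated H p.1)) {w : Ω}
    (hw : ∀ᵐ R ∂unitaryHaar N, groundOutput H E₀ prep R w ≠ 0) :
    (unitaryHaar N).map (fun R => groundDirection H E₀ prep R w)
      = (uniformSphere (energySpace H E₀)).map Subtype.val := by
  have hmeas : Measurable fun R => groundDirection H E₀ prep R w :=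
    measurable_groundDirection_left hprep w
  have := Measure.isProbabilityMeasure_map (μ := unitaryHaar N) hmeas.aemeasurable
  refine eq_uniformSphere_map_coe _ ?_ fun u => ?_
  · have hset : MeasurableSet {x : energySpace H E₀ | ‖x‖ = 1} :=
      measurableSet_eq_fun measurable_norm measurable_const
    rw [ae_map_iff hmeas.aemeasurable hset]
    filter_upwards [hw] with R hR
    exact norm_groundDirection hR
  · obtain ⟨W, hW⟩ := exists_unitaryGroup_groundDirection_mul (E₀ := E₀) (prep := prep) hH u
    rw [Measure.map_map u.continuous.measurable hmeas]
    conv_rhs => rw [← map_mul_left_eq_self (unitaryHaar N) W,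
      Measure.map_map hmeas (measurable_const_mul W)]
    exact congrArg (Measure.map · _) (funext fun R => (hW R w).symm)

end

/-! ### Overlaps, escape probabilities and linear independence under the uniform law -/

section Independence
variable {E : Type*} [NormedAddCommGroup E] [NormedSpace ℂ E] [FiniteDimensional ℂ E]
  [MeasurableSpace E] [BorelSpace E]

/-- Independent samples from a law that charges no proper subspace are almost surely linearly
independent, as long as they are not more than the dimension. -/
theorem ae_linearIndependent_pi (ρ : Measure E) [IsProbabilityMeasure ρ]
    (hρ : ∀ V : Submodule ℂ E, V ≠ ⊤ → ∀ᵐ x ∂ρ, x ∉ V) {k : ℕ} (hk : k ≤ finrank ℂ E) :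
    ∀ᵐ x ∂Measure.pi fun _ : Fin k => ρ, LinearIndependent ℂ x := by
  have : ProperSpace E := FiniteDimensional.proper ℂ E
  induction k with
  | zero => exact .of_forall fun x => linearIndependent_empty_type
  | succ k ih =>
    have hmeas : MeasurableSet
        {p : (Fin k → E) × E | LinearIndependent ℂ (Fin.cons p.2 p.1 : Fin (k + 1) → E)} := by
      have hopen : IsOpen {f : Fin (k + 1) → E | LinearIndependent ℂ f} :=
        isOpen_setOfPred_linearIndependent
      have hcont : Continuous fun p : (Fin k → E) × E =>
          (Fin.cons p.2 p.1 : Fin (k + 1) → E) :=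
        Continuous.finCons (A := fun _ : Fin (k + 1) => E) continuous_snd continuous_fst
      exact (hopen.preimage hcont).measurableSet
    have hprod : ∀ᵐ p ∂(Measure.pi fun _ : Fin k => ρ).prod ρ,
        LinearIndependent ℂ (Fin.cons p.2 p.1 : Fin (k + 1) → E) := by
      rw [Measure.ae_prod_iff_ae_ae hmeas]
      filter_upwards [ih (by omega)] with x hx
      have hspan : Submodule.span ℂ (Set.range x) ≠ ⊤ := by
        intro h
        have h1 := finrank_span_eq_card hx
        rw [h, finrank_top, Fintype.card_fin] at h1
        omega
      filter_upwards [hρ _ hspan] with y hy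
      exact linearIndependent_finCons.2 ⟨hx, hy⟩
    have hpres := Measure.measurePreserving_swap.comp
      (measurePreserving_piFinSuccAbove (fun _ : Fin (k + 1) => ρ) 0)
    filter_upwards [hpres.quasiMeasurePreserving.ae hprod] with x hx
    convert! hx using 1
    exact (Fin.cons_self_tail x).symm
end Independence

section Sphere
variable {E : Type*} [NormedAddCommGroup E] [InnerProductSpace ℂ E] [FiniteDimensional ℂ E]
  [MeasurableSpace E] [BorelSpace E]

/-- The uniform probability measure on the unit sphere of `E`, as a measure on `E`. -/
def uniformDirection (E : Type*) [NormedAddCommGroup E] [InnerProductSpace ℂ E]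
    [FiniteDimensional ℂ E] [MeasurableSpace E] [BorelSpace E] : Measure E :=
  (uniformSphere E).map Subtype.val

instance instIsProbabilityMeasureUniformDirection [Nontrivial E] :
    IsProbabilityMeasure (uniformDirection E) :=
  have := isProbabilityMeasure_uniformSphere (E := E)
  Measure.isProbabilityMeasure_map measurable_subtype_coe.aemeasurable

theorem uniformDirection_real_le_norm_inner_sq {n : E} (hn : ‖n‖ = 1) {t : ℝ}
    (ht : t ∈ Set.Icc (0 : ℝ) 1) :
    (uniformDirection E).real {x | t ≤ ‖inner ℂ n x‖ ^ 2} = (1 - t) ^ (finrank ℂ E - 1) := by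
  have : Nontrivial E := ⟨n, 0, by rintro rfl; simp at hn⟩
  exact measureReal_le_norm_inner_sq (uniformDirection E)
    ae_norm_eq_one_uniformSphere uniformSphere_map_coe_map hn ht

theorem uniformDirection_map_norm_inner_sq {n : E} (hn : ‖n‖ = 1) :
    (uniformDirection E).map (fun x => ‖inner ℂ n x‖ ^ 2) = betaOneLaw (finrank ℂ E) := by
  have : Nontrivial E := ⟨n, 0, by rintro rfl; simp at hn⟩
  have hmeas : Measurable fun x : E => ‖inner ℂ n x‖ ^ 2 := by fun_prop
  have := Measure.isProbabilityMeasure_map (μ := uniformDirection E) hmeas.aemeasurable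
  refine eq_betaOneLaw finrank_pos _ ?_ fun t ht => ?_
  · rw [ae_map_iff hmeas.aemeasurable measurableSet_Iic]
    have hone : ∀ᵐ x ∂uniformDirection E, ‖x‖ = 1 := ae_norm_eq_one_uniformSphere
    filter_upwards [hone] with x hx
    have := norm_inner_le_norm (𝕜 := ℂ) n x
    rw [hn, hx, mul_one] at this
    exact pow_le_one₀ (norm_nonneg _) this
  · rw [map_measureReal_apply hmeas measurableSet_Ici]
    exact uniformDirection_real_le_norm_inner_sq hn ht

theorem betaOneLaw_singleton_zero {g : ℕ} : betaOneLaw g {0} = 0 := by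
  unfold betaOneLaw
  split_ifs with h
  · simp
  · exact withDensity_absolutelyContinuous _ _ (by simp)

/-- A proper subspace lies in the zero set of the overlap with some unit vector, and the law of that
overlap does not charge `0`. -/
theorem ae_notMem_uniformDirection (V : Submodule ℂ E) (hV : V ≠ ⊤) :
    ∀ᵐ x ∂uniformDirection E, x ∉ V := by
  obtain ⟨y, hy, hy0⟩ := Submodule.exists_mem_ne_zero_of_ne_bot
    (mt Submodule.orthogonal_eq_bot_iff.1 hV)
  let n : E := (‖y‖⁻¹ : ℂ) • y
  have hn : ‖n‖ = 1 := by simp [n, norm_smul, hy0]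
  have hnV : n ∈ Vᗮ := Vᗮ.smul_mem _ hy
  have h0 : (uniformDirection E).map (fun x => ‖inner ℂ n x‖ ^ 2) {0} = 0 := by
    rw [uniformDirection_map_norm_inner_sq hn, betaOneLaw_singleton_zero]
  rw [Measure.map_apply (by fun_prop) (measurableSet_singleton 0)] at h0
  rw [ae_iff]
  refine measure_mono_null (fun x hx => ?_) h0
  have hxV : x ∈ V := not_not.1 hx
  simp [Submodule.inner_left_of_mem_orthogonal hxV hnV]

theorem ae_linearIndependent_pi_uniformDirection [Nontrivial E] :
    ∀ᵐ x ∂Measure.pi fun _ : Fin (finrank ℂ E) => uniformDirection E, LinearIndependent ℂ x :=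
  ae_linearIndependent_pi _ ae_notMem_uniformDirection le_rfl

end Sphere

section Ambient
variable {N : ℕ} {G V : Submodule ℂ (Hilb N)}

theorem uniformOnSphere_eq_map : uniformOnSphere G = (uniformDirection G).map Subtype.val := by
  rw [uniformDirection, Measure.map_map measurable_subtype_coe measurable_subtype_coe]
  rfl

theorem uniformOnSphere_real_le_norm_inner_sq {n : Hilb N} (hnG : n ∈ G) (hn : ‖n‖ = 1) {t : ℝ}
    (ht : t ∈ Set.Icc (0 : ℝ) 1) :
    (uniformOnSphere G).real {x | t ≤ ‖inner ℂ n x‖ ^ 2} = (1 - t) ^ (finrank ℂ G - 1) := by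
  have hmeas : MeasurableSet {x : Hilb N | t ≤ ‖inner ℂ n x‖ ^ 2} :=
    measurableSet_le measurable_const (by fun_prop)
  rw [uniformOnSphere_eq_map, map_measureReal_apply measurable_subtype_coe hmeas]
  exact uniformDirection_real_le_norm_inner_sq (n := (⟨n, hnG⟩ : G)) hn ht

theorem uniformOnSphere_map_norm_inner_sq {n : Hilb N} (hnG : n ∈ G) (hn : ‖n‖ = 1) :
    (uniformOnSphere G).map (fun x => ‖inner ℂ n x‖ ^ 2) = betaOneLaw (finrank ℂ G) := by
  rw [uniformOnSphere_eq_map, Measure.map_map (by fun_prop) measurable_subtype_coe]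
  exact uniformDirection_map_norm_inner_sq (n := (⟨n, hnG⟩ : G)) hn

/-- A hyperplane `V` of `G` has a unit normal in `G`, which accounts for the rest of the norm. -/
theorem IsHyperplaneOf.exists_normal (h : IsHyperplaneOf V G) :
    ∃ n ∈ G, ‖n‖ = 1 ∧ ∀ x ∈ G, ‖x‖ ^ 2 = ‖V.starProjection x‖ ^ 2 + ‖inner ℂ n x‖ ^ 2 := by
  have hdim : finrank ℂ (Vᗮ ⊓ G : Submodule ℂ (Hilb N)) = 1 := by
    have := Submodule.finrank_add_inf_finrank_orthogonal h.1
    have := h.2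
    omega
  obtain ⟨y, hy0, hy⟩ := finrank_eq_one_iff'.1 hdim
  have hy0' : (y : Hilb N) ≠ 0 := fun h => hy0 (Subtype.ext h)
  let n : Hilb N := (‖(y : Hilb N)‖⁻¹ : ℂ) • (y : Hilb N)
  have hn : ‖n‖ = 1 := by simp [n, norm_smul, hy0']
  refine ⟨n, G.smul_mem _ y.2.2, hn, fun x hx => ?_⟩
  have hnV : n ∈ Vᗮ := Vᗮ.smul_mem _ y.2.1
  have hmem : x - V.starProjection x ∈ Vᗮ ⊓ G :=
    ⟨V.sub_starProjection_mem_orthogonal x, G.sub_mem hx (h.1 (V.starProjection_apply_mem x))⟩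
  obtain ⟨c, hc⟩ := hy ⟨_, hmem⟩
  have hc' : c • (y : Hilb N) = x - V.starProjection x := congrArg Subtype.val hc
  have hcn : x - V.starProjection x = (c * ‖(y : Hilb N)‖) • n := by
    rw [← hc', mul_smul, smul_inv_smul₀ (by simpa using hy0')]
  have hinner : inner ℂ n x = c * ‖(y : Hilb N)‖ := by
    rw [← sub_add_cancel x (V.starProjection x), inner_add_right,
      Submodule.inner_left_of_mem_orthogonal (V.starProjection_apply_mem x) hnV, hcn,
      inner_smul_right, inner_self_eq_norm_sq_to_K, hn]
    simp
  rw [V.norm_sq_eq_add_norm_sq_starProjection x, Submodule.starProjection_orthogonal_val, hcn,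
    norm_smul, hn, mul_one, hinner]

theorem uniformOnSphere_real_le_fsDist (h : IsHyperplaneOf V G) {δ : ℝ}
    (hδ : δ ∈ Set.Icc 0 (Real.pi / 2)) :
    (uniformOnSphere G).real {x | δ ≤ fsDist x V} = haarEta (finrank ℂ G) δ := by
  obtain ⟨n, hnG, hn, hpyth⟩ := h.exists_normal
  have hsin : Real.sin δ ^ 2 ∈ Set.Icc (0 : ℝ) 1 := ⟨sq_nonneg _, Real.sin_sq_le_one δ⟩
  have hcos : 0 ≤ Real.cos δ := Real.cos_nonneg_of_mem_Icc ⟨by linarith [hδ.1, hδ.2], hδ.2⟩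
  have hsphere : ∀ᵐ x ∂uniformOnSphere G, x ∈ G ∧ ‖x‖ = 1 := by
    have hset : MeasurableSet {x : Hilb N | x ∈ G ∧ ‖x‖ = 1} :=
      (G.closed_of_finiteDimensional.inter (isClosed_eq continuous_norm
        continuous_const)).measurableSet
    rw [uniformOnSphere_eq_map, ae_map_iff measurable_subtype_coe.aemeasurable hset]
    have hone : ∀ᵐ x ∂uniformDirection G, ‖x‖ = 1 := ae_norm_eq_one_uniformSphere
    filter_upwards [hone] with x hx
    exact ⟨x.2, hx⟩
  -- on the sphere, `δ ≤ arccos ‖Π_V x‖` reads `1 - ‖⟪n, x⟫‖ ^ 2 ≤ cos ^ 2 δ`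
  have hcongr : {x | δ ≤ fsDist x V} =ᵐ[uniformOnSphere G]
      {x | Real.sin δ ^ 2 ≤ ‖inner ℂ n x‖ ^ 2} := by
    rw [Filter.eventuallyEq_set]
    filter_upwards [hsphere] with x hx
    have h1 := hpyth x hx.1
    rw [hx.2, one_pow] at h1
    have hle : ‖V.starProjection x‖ ≤ 1 := hx.2 ▸ V.norm_starProjection_apply_le x
    have hcosarc : Real.cos (fsDist x V) = ‖V.starProjection x‖ :=
      Real.cos_arccos (by linarith [norm_nonneg (V.starProjection x)]) hle
    have hanti : Real.cos (fsDist x V) ≤ Real.cos δ ↔ δ ≤ fsDist x V :=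
      Real.strictAntiOn_cos.le_iff_ge ⟨Real.arccos_nonneg _, Real.arccos_le_pi _⟩
        ⟨hδ.1, by linarith [hδ.2, Real.pi_pos]⟩
    change δ ≤ fsDist x V ↔ Real.sin δ ^ 2 ≤ ‖inner ℂ n x‖ ^ 2
    rw [← hanti, hcosarc, ← sq_le_sq₀ (norm_nonneg _) hcos]
    have := Real.sin_sq_add_cos_sq δ
    constructor <;> intro h <;> linarith
  rw [measureReal_congr hcongr, uniformOnSphere_real_le_norm_inner_sq hnG hn hsin, haarEta,
    ← Real.cos_sq', pow_mul]

theorem measurableSet_le_fsDist (V : Submodule ℂ (Hilb N)) (δ : ℝ) :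
    MeasurableSet {x | δ ≤ fsDist x V} :=
  (isClosed_le continuous_const
    (Real.continuous_arccos.comp V.starProjection.continuous.norm)).measurableSet

end Ambient

/-! ### Laws along a random branch -/

section Branches
variable {N : ℕ} {H : CMat N} {E₀ : ℝ} {Ω : Type*} [MeasurableSpace Ω]
  {prep : Ω → CMat N → Hilb N}
  {S : Type*} [MeasurableSpace S] {μ : Measure S} [IsProbabilityMeasure μ]

theorem nontrivial_energySpace (hE₀ : IsGroundEnergy H E₀) : Nontrivial (energySpace H E₀) :=
  Submodule.nontrivial_iff_ne_bot.2 hE₀.1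

theorem measurable_normalizedFootPoint
    (hprep : Measurable fun p : UN N × Ω => prep p.2 (rotated H p.1)) :
    Measurable fun p : UN N × Ω => normalizedFootPoint (footPoint H E₀ prep) p.1 p.2 := by
  have h := measurable_subtype_coe.comp (measurable_groundDirection (E₀ := E₀) hprep)
  convert! h using 2 with p
  exact normalizedFootPoint_eq H E₀ prep p.1 p.2

theorem measurable_normalizedFootPoint_left
    (hprep : Measurable fun p : UN N × Ω => prep p.2 (rotated H p.1)) (w : Ω) :
    Measurable fun R : UN N => normalizedFootPoint (footPoint H E₀ prep) R w := by
  have h : Measurable fun R : UN N => (R, w) := measurable_id.prodMk measurable_const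
  have h' := (measurable_normalizedFootPoint (E₀ := E₀) hprep).comp h
  exact h'

theorem map_normalizedFootPoint_eq_uniformOnSphere [Nontrivial (energySpace H E₀)]
    (hH : H.IsHermitian)
    (hprep : Measurable fun p : UN N × Ω => prep p.2 (rotated H p.1)) {w : Ω}
    (hw : ∀ᵐ R ∂unitaryHaar N, groundOutput H E₀ prep R w ≠ 0) :
    (unitaryHaar N).map (fun R => normalizedFootPoint (footPoint H E₀ prep) R w)
      = uniformOnSphere (energySpace H E₀) := by
  simp only [normalizedFootPoint_eq]
  have h := measurable_groundDirection_left (E₀ := E₀) hprep w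
  rw [uniformOnSphere_eq_map, uniformDirection, ← map_groundDirection_eq_uniform hH hprep hw,
    Measure.map_map measurable_subtype_coe h]
  rfl

/-- By independence of rotation and internal randomness, nonvanishing along the branch passes to
almost every value of the randomness. -/
theorem ae_ae_groundOutput_ne_zero {R : S → UN N} {ω : S → Ω} (hR : Measurable R)
    (hω : Measurable ω) (hHaar : μ.map R = unitaryHaar N) (hRω : IndepFun R ω μ)
    (hprep : Measurable fun p : UN N × Ω => prep p.2 (rotated H p.1))
    (hnz : ∀ᵐ s ∂μ, groundOutput H E₀ prep (R s) (ω s) ≠ 0) :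
    ∀ᵐ w ∂μ.map ω, ∀ᵐ U ∂unitaryHaar N, groundOutput H E₀ prep U w ≠ 0 := by
  have hlaw : μ.map (fun s => (ω s, R s)) = (μ.map ω).prod (unitaryHaar N) := by
    rw [← hHaar]
    exact (indepFun_iff_map_prod_eq_prod_map_map hω.aemeasurable hR.aemeasurable).1 hRω.symm
  have hmeas : MeasurableSet {p : Ω × UN N | groundOutput H E₀ prep p.2 p.1 ≠ 0} := by
    have h := (measurable_groundOutput (E₀ := E₀) hprep).comp measurable_swap
    exact h (measurableSet_singleton 0).compl
  refine Measure.ae_ae_of_ae_prod (p := fun p => groundOutput H E₀ prep p.2 p.1 ≠ 0) ?_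
  rw [← hlaw, ae_map_iff (hω.prodMk hR).aemeasurable hmeas]
  exact hnz

/-- The conditional law given the internal randomness is uniform for almost every value, hence so
is the unconditional law. -/
theorem map_groundDirection_comp_eq_uniformDirection [Nontrivial (energySpace H E₀)]
    (hH : H.IsHermitian) {R : S → UN N} {ω : S → Ω} (hR : Measurable R)
    (hω : Measurable ω) (hHaar : μ.map R = unitaryHaar N) (hRω : IndepFun R ω μ)
    (hprep : Measurable fun p : UN N × Ω => prep p.2 (rotated H p.1))
    (hw : ∀ᵐ w ∂μ.map ω, ∀ᵐ U ∂unitaryHaar N, groundOutput H E₀ prep U w ≠ 0) :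
    μ.map (fun s => groundDirection H E₀ prep (R s) (ω s))
      = uniformDirection (energySpace H E₀) := by
  have hlaw : μ.map (fun s => (ω s, R s)) = (μ.map ω).prod (unitaryHaar N) := by
    rw [← hHaar]
    exact (indepFun_iff_map_prod_eq_prod_map_map hω.aemeasurable hR.aemeasurable).1 hRω.symm
  have hdir : Measurable fun p : Ω × UN N => groundDirection H E₀ prep p.2 p.1 := by
    have h := (measurable_groundDirection (E₀ := E₀) hprep).comp measurable_swap
    exact h
  have hcomp : μ.map (fun s => groundDirection H E₀ prep (R s) (ω s))
      = (μ.map fun s => (ω s, R s)).map fun p => groundDirection H E₀ prep p.2 p.1 := by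
    rw [Measure.map_map hdir (hω.prodMk hR)]
    rfl
  have := Measure.isProbabilityMeasure_map (μ := μ) hω.aemeasurable
  rw [hcomp, hlaw]
  ext A hA
  rw [Measure.map_apply hdir hA, Measure.prod_apply (hdir hA)]
  have hslice : ∀ᵐ w ∂μ.map ω, unitaryHaar N
      (Prod.mk w ⁻¹' ((fun p : Ω × UN N => groundDirection H E₀ prep p.2 p.1) ⁻¹' A))
      = uniformDirection (energySpace H E₀) A := by
    filter_upwards [hw] with w hw
    rw [uniformDirection, ← map_groundDirection_eq_uniform hH hprep hw,
      Measure.map_apply (measurable_groundDirection_left hprep w) hA]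
    rfl
  rw [lintegral_congr_ae hslice, lintegral_const, measure_univ, mul_one]

/-- With at least `dim 𝓖` branches, the ground components of the outputs almost surely span `𝓖`:
already the directions of the first `dim 𝓖` branches are linearly independent. -/
theorem ae_span_groundOutput_eq_top [Nontrivial (energySpace H E₀)] (hH : H.IsHermitian)
    (hprep : Measurable fun p : UN N × Ω => prep p.2 (rotated H p.1))
    {M : ℕ} {R : Fin M → S → UN N} {ω : Fin M → S → Ω}
    (hR : ∀ i, Measurable (R i)) (hω : ∀ i, Measurable (ω i))
    (hHaar : ∀ i, μ.map (R i) = unitaryHaar N) (hRω : ∀ i, IndepFun (R i) (ω i) μ)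
    (hind : iIndepFun (fun i s => (R i s, ω i s)) μ)
    (hnz : ∀ i, ∀ᵐ s ∂μ, groundOutput H E₀ prep (R i s) (ω i s) ≠ 0)
    (hM : finrank ℂ (energySpace H E₀) ≤ M) :
    ∀ᵐ s ∂μ, Submodule.span ℂ (Set.range fun i => groundOutput H E₀ prep (R i s) (ω i s)) = ⊤ := by
  set G := energySpace H E₀
  let Y : Fin (finrank ℂ G) → S → G := fun j s =>
    groundDirection H E₀ prep (R (Fin.castLE hM j) s) (ω (Fin.castLE hM j) s)
  have hdir := measurable_groundDirection (E₀ := E₀) hprep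
  have hYmeas : ∀ j, Measurable (Y j) := fun j => by
    have h := hdir.comp ((hR (Fin.castLE hM j)).prodMk (hω (Fin.castLE hM j)))
    exact h
  have hYind : iIndepFun Y μ := by
    have h := (hind.precomp (Fin.castLE_injective hM)).comp
      (fun _ p => groundDirection H E₀ prep p.1 p.2) fun _ => hdir
    exact h
  have hYlaw : ∀ j, μ.map (Y j) = uniformDirection G := fun j =>
    map_groundDirection_comp_eq_uniformDirection hH (hR _) (hω _) (hHaar _) (hRω _) hprep
      (ae_ae_groundOutput_ne_zero (hR _) (hω _) (hHaar _) (hRω _) hprep (hnz _))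
  have hlaw : μ.map (fun s j => Y j s) = Measure.pi fun _ => uniformDirection G := by
    rw [(iIndepFun_iff_map_fun_eq_pi_map fun j => (hYmeas j).aemeasurable).1 hYind]
    simp only [hYlaw]
  have hindep := ae_linearIndependent_pi_uniformDirection (E := G)
  rw [← hlaw] at hindep
  filter_upwards [ae_of_ae_map (measurable_pi_lambda _ hYmeas).aemeasurable hindep] with s hs
  rw [eq_top_iff, ← hs.span_eq_top_of_card_eq_finrank' (by simp)]
  refine Submodule.span_le.2 ?_
  rintro _ ⟨j, rfl⟩
  exact Submodule.smul_mem _ _ (Submodule.subset_span ⟨Fin.castLE hM j, rfl⟩)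

end Branches

/-! ### Anti-concentration and diversity -/

/-- The columns of the foot-point matrix are the coordinate vectors of the ground components. -/
theorem rank_footMatrix_eq {N g M : ℕ} {H : CMat N} {E₀ : ℝ} {Ω : Type*}
    {prep : Ω → CMat N → Hilb N} (v : OrthonormalBasis (Fin g) ℂ (energySpace H E₀))
    (R : Fin M → UN N) (w : Fin M → Ω)
    (hspan : Submodule.span ℂ (Set.range fun i => groundOutput H E₀ prep (R i) (w i)) = ⊤) :
    (footMatrix H prep (fun k => (v k : Hilb N)) R w).rank = g := by
  let e : energySpace H E₀ ≃ₗ[ℂ] (Fin g → ℂ) :=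
    v.repr.toLinearEquiv.trans (WithLp.linearEquiv 2 ℂ (Fin g → ℂ))
  have hcol : Set.range (footMatrix H prep (fun k => (v k : Hilb N)) R w).col
      = e '' Set.range fun i => groundOutput H E₀ prep (R i) (w i) := by
    rw [← Set.range_comp]
    congr 1
    ext i k
    change inner ℂ (v k : Hilb N) (act (R i : CMat N) (prep (w i) (rotated H (R i))))
      = v.repr (groundOutput H E₀ prep (R i) (w i)) k
    rw [v.repr_apply_apply, groundOutput, Submodule.inner_orthogonalProjectionOnto_eq_of_mem_left]
  rw [Matrix.rank_eq_finrank_span_cols, hcol]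
  have hmap := Submodule.map_span (e : energySpace H E₀ →ₗ[ℂ] (Fin g → ℂ))
    (Set.range fun i => groundOutput H E₀ prep (R i) (w i))
  rw [hspan, Submodule.map_top, LinearEquiv.range] at hmap
  rw [LinearEquiv.coe_coe] at hmap
  rw [← hmap, finrank_top, finrank_fin_fun]

theorem haarEta_mem_Ioc (g : ℕ) {δ : ℝ} (hδ : δ ∈ Set.Ioo 0 (Real.pi / 2)) :
    haarEta g δ ∈ Set.Ioc (0 : ℝ) 1 := by
  have hcos : 0 < Real.cos δ := Real.cos_pos_of_mem_Ioo ⟨by linarith [hδ.1, hδ.2], hδ.2⟩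
  exact ⟨pow_pos hcos _, pow_le_one₀ hcos.le (Real.cos_le_one δ)⟩

theorem tendsto_haarEta (g : ℕ) : Tendsto (haarEta g) (𝓝[>] 0) (𝓝 1) := by
  have hcont : Continuous (haarEta g) := Real.continuous_cos.pow _
  have h := hcont.tendsto 0
  rw [haarEta, Real.cos_zero, one_pow] at h
  exact h.mono_left nhdsWithin_le_nhds

end

theorem mainTheorem4
    -- the Hamiltonian and its `g`-dimensional ground space
    {N : ℕ} (H : CMat N) (hH : H.IsHermitian) (E₀ : ℝ) (hE₀ : IsGroundEnergy H E₀)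
    (g : ℕ) (hg : finrank ℂ (energySpace H E₀) = g)
    -- the preparation rule with internal randomness in `Ω`
    {Ω : Type*} [MeasurableSpace Ω] (prep : Ω → CMat N → Hilb N)
    (hprep : Measurable fun p : UN N × Ω => prep p.2 (rotated H p.1))
    -- `M` independent branches: a Haar rotation and an independent internal randomness in each
    {S : Type*} [MeasurableSpace S] (μ : Measure S) [IsProbabilityMeasure μ]
    (M : ℕ) (R : Fin M → S → UN N) (ω : Fin M → S → Ω)
    (hR : ∀ i, Measurable (R i)) (hω : ∀ i, Measurable (ω i))
    (hHaar : ∀ i, μ.map (R i) = unitaryHaar N)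
    (hRω : ∀ i, IndepFun (R i) (ω i) μ)
    (hind : iIndepFun (fun i s => (R i s, ω i s)) μ)
    -- the output has a nonzero ground-space component almost surely on every branch
    (hnz : ∀ i, ∀ᵐ s ∂μ, (energySpace (rotated H (R i s)) E₀).starProjection
      (prep (ω i s) (rotated H (R i s))) ≠ 0) :
    -- given the internal randomness: uniform law, Beta overlaps, escape probabilities
    (∀ i, ∀ᵐ w ∂(μ.map (ω i)),
      (unitaryHaar N).map (fun U => normalizedFootPoint (footPoint H E₀ prep) U w)
        = uniformOnSphere (energySpace H E₀) ∧
      (∀ n ∈ energySpace H E₀, ‖n‖ = 1 →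
        (unitaryHaar N).map
            (fun U => ‖inner ℂ n (normalizedFootPoint (footPoint H E₀ prep) U w)‖ ^ 2)
          = betaOneLaw g ∧
        ∀ t ∈ Set.Icc (0 : ℝ) 1,
          (unitaryHaar N).real
              {U | t ≤ ‖inner ℂ n (normalizedFootPoint (footPoint H E₀ prep) U w)‖ ^ 2}
            = (1 - t) ^ (g - 1)) ∧
      (∀ V, IsHyperplaneOf V (energySpace H E₀) → ∀ δ ∈ Set.Icc 0 (Real.pi / 2),
        (unitaryHaar N).real
            {U | δ ≤ fsDist (normalizedFootPoint (footPoint H E₀ prep) U w) V}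
          = haarEta g δ)) ∧
    -- the same laws without conditioning
    (∀ i,
      μ.map (fun s => normalizedFootPoint (footPoint H E₀ prep) (R i s) (ω i s))
        = uniformOnSphere (energySpace H E₀) ∧
      (∀ n ∈ energySpace H E₀, ‖n‖ = 1 →
        μ.map (fun s =>
            ‖inner ℂ n (normalizedFootPoint (footPoint H E₀ prep) (R i s) (ω i s))‖ ^ 2)
          = betaOneLaw g)) ∧
    -- anti-concentration with the constant `cos^{2(g-1)} δ`
    (∀ i, ∀ δ ∈ Set.Ioo 0 (Real.pi / 2),
      AntiConcentration (unitaryHaar N) (μ.map (ω i)) (energySpace H E₀)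
        (footPoint H E₀ prep) (haarEta g δ) δ) ∧
    -- the limit `δ → 0`
    Tendsto (haarEta g) (𝓝[>] 0) (𝓝 1) ∧
    Tendsto (fun δ => haarEta g δ ^ g) (𝓝[>] 0) (𝓝 1) ∧
    -- diversity: the bound at each `δ`, and the almost sure spanning in the limit
    (g ≤ M →
      (∀ v : OrthonormalBasis (Fin g) ℂ (energySpace H E₀),
        (∀ δ ∈ Set.Ioo 0 (Real.pi / 2),
          haarEta g δ ^ g ≤ μ.real {s |
            (footMatrix H prep (fun k => (v k : Hilb N)) (fun i => R i s)
              (fun i => ω i s)).rank = g}) ∧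
        ∀ᵐ s ∂μ, (footMatrix H prep (fun k => (v k : Hilb N)) (fun i => R i s)
          (fun i => ω i s)).rank = g) ∧
      ∀ᵐ s ∂μ, Submodule.span ℂ (Set.range fun i =>
        (energySpace H E₀).starProjection
          (act (R i s : CMat N) (prep (ω i s) (rotated H (R i s))))) = energySpace H E₀) := by
  subst hg
  have : Nontrivial (energySpace H E₀) := nontrivial_energySpace hE₀
  have hnz' : ∀ i, ∀ᵐ s ∂μ, groundOutput H E₀ prep (R i s) (ω i s) ≠ 0 := by
    intro i
    filter_upwards [hnz i] with s hs
    exact (groundOutput_ne_zero_iff H E₀ prep _ _).2 hs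
  have hfiber : ∀ i, ∀ᵐ w ∂μ.map (ω i), ∀ᵐ U ∂unitaryHaar N, groundOutput H E₀ prep U w ≠ 0 :=
    fun i => ae_ae_groundOutput_ne_zero (hR i) (hω i) (hHaar i) (hRω i) hprep (hnz' i)
  have hoverlap : ∀ n : Hilb N, Measurable fun x : Hilb N => ‖inner ℂ n x‖ ^ 2 := fun n => by
    fun_prop
  have hcond : ∀ i, ∀ᵐ w ∂(μ.map (ω i)),
      (unitaryHaar N).map (fun U => normalizedFootPoint (footPoint H E₀ prep) U w)
        = uniformOnSphere (energySpace H E₀) := by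
    intro i
    filter_upwards [hfiber i] with w hw
    exact map_normalizedFootPoint_eq_uniformOnSphere hH hprep hw
  have hescape : ∀ i, ∀ᵐ w ∂(μ.map (ω i)), ∀ V, IsHyperplaneOf V (energySpace H E₀) →
      ∀ δ ∈ Set.Icc 0 (Real.pi / 2),
        (unitaryHaar N).real
            {U | δ ≤ fsDist (normalizedFootPoint (footPoint H E₀ prep) U w) V}
          = haarEta (finrank ℂ (energySpace H E₀)) δ := by
    intro i
    filter_upwards [hcond i] with w hw V hV δ hδ
    rw [← uniformOnSphere_real_le_fsDist hV hδ, ← hw,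
      map_measureReal_apply (measurable_normalizedFootPoint_left hprep w)
        (measurableSet_le_fsDist V δ)]
    rfl
  have huncond : ∀ i,
      μ.map (fun s => normalizedFootPoint (footPoint H E₀ prep) (R i s) (ω i s))
        = uniformOnSphere (energySpace H E₀) := by
    intro i
    simp only [normalizedFootPoint_eq]
    have hdir : Measurable fun s => groundDirection H E₀ prep (R i s) (ω i s) := by
      have h := (measurable_groundDirection (E₀ := E₀) hprep).comp ((hR i).prodMk (hω i))
      exact h
    rw [uniformOnSphere_eq_map, ← map_groundDirection_comp_eq_uniformDirection hH (hR i) (hω i)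
      (hHaar i) (hRω i) hprep (hfiber i), Measure.map_map measurable_subtype_coe hdir]
    rfl
  refine ⟨fun i => ?_, fun i => ⟨huncond i, fun n hnG hn => ?_⟩, fun i δ hδ => ?_,
    tendsto_haarEta _, ?_, fun hM => ?_⟩
  · filter_upwards [hcond i, hescape i] with w hw hw'
    have hfoot := measurable_normalizedFootPoint_left (E₀ := E₀) hprep w
    refine ⟨hw, fun n hnG hn => ⟨?_, fun t ht => ?_⟩, hw'⟩
    · rw [← uniformOnSphere_map_norm_inner_sq hnG hn, ← hw, Measure.map_map (hoverlap n) hfoot]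
      rfl
    · rw [← uniformOnSphere_real_le_norm_inner_sq hnG hn ht, ← hw,
        map_measureReal_apply hfoot (measurableSet_le measurable_const (hoverlap n))]
      rfl
  · have hfoot : Measurable fun s =>
        normalizedFootPoint (footPoint H E₀ prep) (R i s) (ω i s) := by
      have h := (measurable_normalizedFootPoint (E₀ := E₀) hprep).comp ((hR i).prodMk (hω i))
      exact h
    rw [← uniformOnSphere_map_norm_inner_sq hnG hn, ← huncond i,
      Measure.map_map (hoverlap n) hfoot]
    rfl
  · refine ⟨(haarEta_mem_Ioc _ hδ).1, (haarEta_mem_Ioc _ hδ).2, hδ.1, ?_⟩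
    filter_upwards [hescape i] with w hw V hV
    exact (hw V hV δ ⟨hδ.1.le, hδ.2.le⟩).ge
  · simpa using (tendsto_haarEta (finrank ℂ (energySpace H E₀))).pow
      (finrank ℂ (energySpace H E₀))
  have hspan := ae_span_groundOutput_eq_top hH hprep hR hω hHaar hRω hind hnz' hM
  refine ⟨fun v => ?_, ?_⟩
  · have hrank : ∀ᵐ s ∂μ, (footMatrix H prep (fun k => (v k : Hilb N)) (fun i => R i s)
        (fun i => ω i s)).rank = finrank ℂ (energySpace H E₀) := by
      filter_upwards [hspan] with s hs
      exact rank_footMatrix_eq v _ _ hs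
    refine ⟨fun δ hδ => ?_, hrank⟩
    have hone : μ.real {s | (footMatrix H prep (fun k => (v k : Hilb N)) (fun i => R i s)
        (fun i => ω i s)).rank = finrank ℂ (energySpace H E₀)} = 1 := by
      rw [measureReal_congr (eventuallyEq_univ.2 hrank), probReal_univ]
    rw [hone]
    exact pow_le_one₀ (haarEta_mem_Ioc _ hδ).1.le (haarEta_mem_Ioc _ hδ).2
  · filter_upwards [hspan] with s hs
    have hmap := Submodule.map_span (energySpace H E₀).subtype
      (Set.range fun i => groundOutput H E₀ prep (R i s) (ω i s))
    rw [hs, Submodule.map_top, Submodule.range_subtype, ← Set.range_comp] at hmap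
    exact hmap.symm
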